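/- Let $E$ be a complex Banach lattice, i.e. the complexification of a real Banach lattice, with positive cone $E_+$. Let $(P_n)_{n\in\mathbb N}$ be a sequence of positive linear operators on $E$ (positive: $P_nE_+\subseteq E_+$) that is increasing (each $P_{n+1}-P_n$ is positive) and converges strongly to the identity. Let $(e^{tA})_{t\ge 0}$ be a $C_0$-semigroup on $E$ with generator $A$ that is locally eventually positive (LEP) with respect to $(P_n)$: for every $n\in\mathbb N$ and every $f\in E_+\setminus\{0\}$ there exists $\tau>0$ (depending on $n$ and $f$) such that $P_n e^{tA}f\ge 0$ for all $t\ge\tau$. Let $s(A):=\sup\{\operatorname{Re}\lambda:\lambda\in\sigma(A)\}\in[-\infty,\infty]$ be the spectral bound, let $\sigma_{\mathrm{ess}}(A)$ be the set of all $\lambda\in\mathbb C$ for which $A-\lambda I$ is not Fredholm (Fredholm: $\dim\ker(A-\lambda I)<\infty$ and $\operatorname{codim}\operatorname{rg}(A-\lambda I)<\infty$), and let $s_{\mathrm{ess}}(A):=\sup\{\operatorname{Re}\lambda:\lambda\in\sigma_{\mathrm{ess}}(A)\}\in[-\infty,\infty]$, where $\sup\emptyset=-\infty$. **Theorem.** If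 $s_{\mathrm{ess}}(A)<s(A)$, then $s(A)$ is finite and the following assertions hold. (i) $s(A)$ is a pole of the resolvent $R(\cdot,A)=(\,\cdot\,-A)^{-1}$ of some order $m\ge 1$, and $s(A)$ is an eigenvalue of $A$ with a positive eigenvector, i.e. there is $v\in D(A)\cap E_+$, $v\neq 0$, with $Av=s(A)v$. (ii) Every pole of $R(\cdot,A)$ in the peripheral spectrum $\{\lambda\in\sigma(A):\operatorname{Re}\lambda=s(A)\}$ has order at most $m$. -/

import Mathlib

open Filter Topology

noncomputable section

/-! ### Complex Banach lattices -/

/-- The algebraic complexification `F + iF` of a real vector space `F`. -/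
@[ext]
structure Complexification (F : Type*) where
  /-- real part -/
  re : F
  /-- imaginary part -/
  im : F

namespace Complexification

section Algebra

variable {F : Type*} [AddCommGroup F]

instance : Zero (Complexification F) := ⟨⟨0, 0⟩⟩
instance : Add (Complexification F) := ⟨fun z w => ⟨z.re + w.re, z.im + w.im⟩⟩
instance : Neg (Complexification F) := ⟨fun z => ⟨-z.re, -z.im⟩⟩
instance : Sub (Complexification F) := ⟨fun z w => ⟨z.re - w.re, z.im - w.im⟩⟩

@[simp] theorem zero_re : (0 : Complexification F).re = 0 := rfl
@[simp] theorem zero_im : (0 : Complexification F).im = 0 := rfl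
@[simp] theorem add_re (z w : Complexification F) : (z + w).re = z.re + w.re := rfl
@[simp] theorem add_im (z w : Complexification F) : (z + w).im = z.im + w.im := rfl
@[simp] theorem neg_re (z : Complexification F) : (-z).re = -z.re := rfl
@[simp] theorem neg_im (z : Complexification F) : (-z).im = -z.im := rfl
@[simp] theorem sub_re (z w : Complexification F) : (z - w).re = z.re - w.re := rfl
@[simp] theorem sub_im (z w : Complexification F) : (z - w).im = z.im - w.im := rfl

instance : AddCommGroup (Complexification F) where
  add_assoc a b c := by ext <;> simp [add_assoc]
  zero_add a := by ext <;> simp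
  add_zero a := by ext <;> simp
  add_comm a b := by ext <;> simp [add_comm]
  neg_add_cancel a := by ext <;> simp
  sub_eq_add_neg a b := by ext <;> simp [sub_eq_add_neg]
  nsmul := nsmulRec
  zsmul := zsmulRec

variable [Module ℝ F]

instance : SMul ℂ (Complexification F) :=
  ⟨fun c z => ⟨c.re • z.re - c.im • z.im, c.re • z.im + c.im • z.re⟩⟩

@[simp] theorem smul_re (c : ℂ) (z : Complexification F) :
    (c • z).re = c.re • z.re - c.im • z.im := rfl
@[simp] theorem smul_im (c : ℂ) (z : Complexification F) :
    (c • z).im = c.re • z.im + c.im • z.re := rfl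

instance : Module ℂ (Complexification F) where
  one_smul z := by ext <;> simp
  mul_smul c d z := by ext <;> simp <;> module
  smul_zero c := by ext <;> simp
  smul_add c z w := by ext <;> simp <;> module
  add_smul c d z := by ext <;> simp <;> module
  zero_smul z := by ext <;> simp

end Algebra

section Modulus

variable {F : Type*} [NormedAddCommGroup F] [Lattice F] [HasSolidNorm F] [IsOrderedAddMonoid F]
  [NormedSpace ℝ F] [IsOrderedModule ℝ F]

/-- The set `{Re (e^{iθ} z) : θ ∈ ℝ}` in the real lattice. -/
def rotations (z : Complexification F) : Set F :=
  {x | ∃ c : ℂ, ‖c‖ = 1 ∧ (c • z).re = x}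

theorem cmp_smul {r s : ℝ} (h : |r| ≤ s) (x : F) : r • x ≤ s • |x| := by
  have hs : 0 ≤ s := (abs_nonneg r).trans h
  rcases le_total 0 r with hr | hr
  · rw [abs_of_nonneg hr] at h
    exact (smul_le_smul_of_nonneg_left (le_abs_self x) hr).trans
      (smul_le_smul_of_nonneg_right h (abs_nonneg x))
  · rw [abs_of_nonpos hr] at h
    have : r • x = (-r) • (-x) := by simp
    rw [this]
    exact (smul_le_smul_of_nonneg_left (neg_le_abs x) (by linarith)).trans
      (smul_le_smul_of_nonneg_right h (abs_nonneg x))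

/-- In a Banach lattice, the supremum `sup_θ Re (e^{iθ} z)` exists. -/
theorem exists_isLUB_rotations [CompleteSpace F] (z : Complexification F) :
    ∃ m, IsLUB (rotations z) m := by
  classical
  set w : F := |z.re| + |z.im| with hw
  have hw0 : 0 ≤ w := add_nonneg (abs_nonneg _) (abs_nonneg _)
  have hlip : ∀ c d : ℂ, (c • z).re ≤ (d • z).re + ‖c - d‖ • w := by
    intro c d
    have h1 := cmp_smul (r := (c - d).re) (s := ‖c - d‖) (Complex.abs_re_le_norm _) z.re
    have h2 := cmp_smul (r := -(c - d).im) (s := ‖c - d‖)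
      (by rw [abs_neg]; exact Complex.abs_im_le_norm _) z.im
    have h3 : (c • z).re = (d • z).re + ((c - d).re • z.re + (-(c - d).im) • z.im) := by
      simp; module
    rw [h3, hw, smul_add]
    gcongr
  have hcomp : IsCompact (Metric.sphere (0 : ℂ) 1) := isCompact_sphere 0 1
  have hnet : ∀ n : ℕ, ∃ t : Finset ℂ, t.Nonempty ∧ (∀ c ∈ t, ‖c‖ = 1) ∧
      ∀ c : ℂ, ‖c‖ = 1 → ∃ d ∈ t, ‖c - d‖ ≤ (1 / 2 : ℝ) ^ n := by
    intro n
    obtain ⟨t, hts, htf, hcov⟩ := hcomp.finite_cover_balls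
      (show (0 : ℝ) < (1 / 2 : ℝ) ^ n by positivity)
    have key : ∀ c : ℂ, ‖c‖ = 1 → ∃ d ∈ htf.toFinset, ‖c - d‖ ≤ (1 / 2 : ℝ) ^ n := by
      intro c hc
      obtain ⟨d, hd, hcd⟩ := Set.mem_iUnion₂.1 (hcov (by simpa using hc))
      exact ⟨d, by simpa using hd, by rw [← dist_eq_norm]; exact (Metric.mem_ball.1 hcd).le⟩
    obtain ⟨d, hd, -⟩ := key 1 (by simp)
    exact ⟨htf.toFinset, ⟨d, hd⟩, fun c hc => by simpa using hts (by simpa using hc), key⟩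
  choose t htne ht1 htnet using hnet
  let m : ℕ → F := fun n => (t n).sup' (htne n) (fun c => (c • z).re)
  have hle : ∀ n (c : ℂ), ‖c‖ = 1 → (c • z).re ≤ m n + ((1 / 2 : ℝ) ^ n) • w := by
    intro n c hc
    obtain ⟨d, hd, hcd⟩ := htnet n c hc
    exact (hlip c d).trans (add_le_add (Finset.le_sup' (fun c : ℂ => (c • z).re) hd)
      (smul_le_smul_of_nonneg_right hcd hw0))
  have hmm : ∀ k n, m k ≤ m n + ((1 / 2 : ℝ) ^ n) • w := fun k n =>
    Finset.sup'_le _ _ fun c hc => hle n c (ht1 k c hc)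
  have hdist : ∀ n k N : ℕ, N ≤ n → N ≤ k → dist (m n) (m k) ≤ (1 / 2 : ℝ) ^ N * ‖w‖ := by
    intro n k N hn hk
    have hmono : ∀ j, N ≤ j → ((1 / 2 : ℝ) ^ j) • w ≤ ((1 / 2 : ℝ) ^ N) • w := fun j hj =>
      smul_le_smul_of_nonneg_right
        (pow_le_pow_of_le_one (by norm_num) (by norm_num) hj) hw0
    have h0 : 0 ≤ ((1 / 2 : ℝ) ^ N) • w := smul_nonneg (by positivity) hw0
    have habs : |m n - m k| ≤ |((1 / 2 : ℝ) ^ N) • w| := by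
      rw [abs_of_nonneg h0]
      refine abs_le'.2 ⟨?_, ?_⟩
      · rw [sub_le_iff_le_add']
        exact (hmm n k).trans (add_le_add le_rfl (hmono k hk))
      · rw [neg_sub, sub_le_iff_le_add']
        exact (hmm k n).trans (add_le_add le_rfl (hmono n hn))
    rw [dist_eq_norm]
    refine (norm_le_norm_of_abs_le_abs habs).trans_eq ?_
    rw [norm_smul, Real.norm_of_nonneg (by positivity)]
  have hpow : Tendsto (fun n : ℕ => (1 / 2 : ℝ) ^ n) atTop (𝓝 0) :=
    tendsto_pow_atTop_nhds_zero_of_lt_one (by norm_num) (by norm_num)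
  have hcau : CauchySeq m := cauchySeq_of_le_tendsto_0 (fun N => (1 / 2 : ℝ) ^ N * ‖w‖)
    hdist (by simpa using hpow.mul_const ‖w‖)
  obtain ⟨l, hl⟩ := cauchySeq_tendsto_of_complete hcau
  refine ⟨l, ?_, ?_⟩
  · rintro x ⟨c, hc, rfl⟩
    have h : Tendsto (fun n => m n + ((1 / 2 : ℝ) ^ n) • w) atTop (𝓝 (l + (0 : ℝ) • w)) :=
      hl.add (hpow.smul_const w)
    rw [zero_smul, add_zero] at h
    exact ge_of_tendsto' h fun n => hle n c hc
  · intro u hu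
    exact le_of_tendsto' hl fun n => Finset.sup'_le _ _ fun c hc => hu ⟨c, ht1 n c hc, rfl⟩

variable [CompleteSpace F]

/-- The modulus `|z| = sup_θ Re (e^{iθ} z)`. -/
def modulus (z : Complexification F) : F := (exists_isLUB_rotations z).choose

theorem isLUB_modulus (z : Complexification F) : IsLUB (rotations z) (modulus z) :=
  (exists_isLUB_rotations z).choose_spec

theorem re_smul_le_modulus (z : Complexification F) {c : ℂ} (hc : ‖c‖ = 1) :
    (c • z).re ≤ modulus z := (isLUB_modulus z).1 ⟨c, hc, rfl⟩

theorem modulus_le {z : Complexification F} {u : F} (h : ∀ c : ℂ, ‖c‖ = 1 → (c • z).re ≤ u) :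
    modulus z ≤ u := (isLUB_modulus z).2 (by rintro x ⟨c, hc, rfl⟩; exact h c hc)

theorem abs_re_le_modulus (z : Complexification F) : |z.re| ≤ modulus z := by
  refine abs_le'.2 ⟨?_, ?_⟩
  · simpa using re_smul_le_modulus z (c := 1) (by simp)
  · simpa using re_smul_le_modulus z (c := -1) (by simp)

theorem abs_im_le_modulus (z : Complexification F) : |z.im| ≤ modulus z := by
  refine abs_le'.2 ⟨?_, ?_⟩
  · simpa using re_smul_le_modulus z (c := -Complex.I) (by simp)
  · simpa using re_smul_le_modulus z (c := Complex.I) (by simp)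

theorem modulus_nonneg (z : Complexification F) : 0 ≤ modulus z :=
  (abs_nonneg _).trans (abs_re_le_modulus z)

theorem modulus_add_le (z w : Complexification F) : modulus (z + w) ≤ modulus z + modulus w :=
  modulus_le fun c hc => by
    rw [smul_add, add_re]
    exact add_le_add (re_smul_le_modulus z hc) (re_smul_le_modulus w hc)

theorem modulus_smul_le (d : ℂ) (z : Complexification F) : modulus (d • z) ≤ ‖d‖ • modulus z := by
  refine modulus_le fun c hc => ?_
  by_cases hd : d = 0
  · simp [hd]
  have hd' : (‖d‖ : ℂ) ≠ 0 := by simpa using hd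
  have h1 : c • d • z = (‖d‖ : ℂ) • ((c * d / ‖d‖) • z) := by
    rw [smul_smul, smul_smul, mul_div_cancel₀ _ hd']
  rw [h1, smul_re]
  simp only [Complex.ofReal_re, Complex.ofReal_im, zero_smul, sub_zero]
  refine smul_le_smul_of_nonneg_left (re_smul_le_modulus z ?_) (norm_nonneg d)
  have : ‖d‖ ≠ 0 := by simpa using hd
  simp [hc, this]

/-- The lattice norm `‖z‖ = ‖|z|‖` of the complexification of a Banach lattice. -/
instance : Norm (Complexification F) := ⟨fun z => ‖modulus z‖⟩

theorem norm_def (z : Complexification F) : ‖z‖ = ‖modulus z‖ := rfl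

theorem norm_mono {x y : F} (hx : 0 ≤ x) (h : x ≤ y) : ‖x‖ ≤ ‖y‖ :=
  norm_le_norm_of_abs_le_abs (by rwa [abs_of_nonneg hx, abs_of_nonneg (hx.trans h)])

theorem norm_smul_le' (d : ℂ) (z : Complexification F) : ‖d • z‖ ≤ ‖d‖ * ‖z‖ := by
  have := norm_mono (modulus_nonneg _) (modulus_smul_le d z)
  rwa [norm_smul, norm_norm] at this

theorem norm_re_le (z : Complexification F) : ‖z.re‖ ≤ ‖z‖ :=
  norm_le_norm_of_abs_le_abs (by
    rw [abs_of_nonneg (modulus_nonneg z)]; exact abs_re_le_modulus z)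

theorem norm_im_le (z : Complexification F) : ‖z.im‖ ≤ ‖z‖ :=
  norm_le_norm_of_abs_le_abs (by
    rw [abs_of_nonneg (modulus_nonneg z)]; exact abs_im_le_modulus z)

instance : NormedAddCommGroup (Complexification F) :=
  AddGroupNorm.toNormedAddCommGroup
    { toFun := fun z => ‖z‖
      map_zero' := by
        have h := norm_smul_le' (0 : ℂ) (0 : Complexification F)
        rw [zero_smul, norm_zero, zero_mul] at h
        exact le_antisymm h (norm_nonneg (modulus (0 : Complexification F)))
      add_le' := fun z w =>
        (norm_mono (modulus_nonneg _) (modulus_add_le z w)).trans (norm_add_le _ _)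
      neg' := fun z => by
        have key : ∀ z : Complexification F, ‖-z‖ ≤ ‖z‖ := fun z => by
          have h := norm_smul_le' (-1 : ℂ) z
          simpa using h
        exact le_antisymm (key z) (by simpa using key (-z))
      eq_zero_of_map_eq_zero' := fun z hz => by
        ext
        · exact norm_le_zero_iff.1 ((norm_re_le z).trans_eq hz)
        · exact norm_le_zero_iff.1 ((norm_im_le z).trans_eq hz) }

instance : NormedSpace ℂ (Complexification F) where
  norm_smul_le := norm_smul_le'

theorem norm_le_add (z : Complexification F) : ‖z‖ ≤ ‖z.re‖ + ‖z.im‖ := by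
  have h : modulus z ≤ |z.re| + |z.im| := modulus_le fun c hc => by
    have h1 := cmp_smul (r := c.re) (s := 1) (by rw [← hc]; exact Complex.abs_re_le_norm c) z.re
    have h2 := cmp_smul (r := -c.im) (s := 1)
      (by rw [← hc, abs_neg]; exact Complex.abs_im_le_norm c) z.im
    rw [one_smul] at h1 h2
    rw [smul_re, sub_eq_add_neg, ← neg_smul]
    exact add_le_add h1 h2
  have h3 := (norm_mono (modulus_nonneg z) h).trans (norm_add_le _ _)
  rwa [norm_abs_eq_norm, norm_abs_eq_norm] at h3

instance : CompleteSpace (Complexification F) := by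
  refine Metric.complete_of_cauchySeq_tendsto fun u hu => ?_
  have hre : CauchySeq fun n => (u n).re := by
    rw [Metric.cauchySeq_iff] at hu ⊢
    intro ε hε
    obtain ⟨N, hN⟩ := hu ε hε
    refine ⟨N, fun m hm n hn => lt_of_le_of_lt ?_ (hN m hm n hn)⟩
    rw [dist_eq_norm, dist_eq_norm]
    exact norm_re_le (u m - u n)
  have him : CauchySeq fun n => (u n).im := by
    rw [Metric.cauchySeq_iff] at hu ⊢
    intro ε hε
    obtain ⟨N, hN⟩ := hu ε hε
    refine ⟨N, fun m hm n hn => lt_of_le_of_lt ?_ (hN m hm n hn)⟩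
    rw [dist_eq_norm, dist_eq_norm]
    exact norm_im_le (u m - u n)
  obtain ⟨a, ha⟩ := cauchySeq_tendsto_of_complete hre
  obtain ⟨b, hb⟩ := cauchySeq_tendsto_of_complete him
  refine ⟨⟨a, b⟩, tendsto_iff_norm_sub_tendsto_zero.2 ?_⟩
  refine squeeze_zero (fun n => norm_nonneg _) (fun n => norm_le_add _) ?_
  have h := (tendsto_iff_norm_sub_tendsto_zero.1 ha).add (tendsto_iff_norm_sub_tendsto_zero.1 hb)
  simpa using h

/-- The positive cone `E₊` of a complex Banach lattice `E`: the positive elements of its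
real part. -/
def positiveCone (F : Type*) [AddCommGroup F] [Lattice F] : Set (Complexification F) :=
  {z | 0 ≤ z.re ∧ z.im = 0}

/-- A linear operator `S` on a complex Banach lattice `E` is positive if `S (E₊) ⊆ E₊`. -/
def IsPositiveOperator (S : Complexification F →ₗ[ℂ] Complexification F) : Prop :=
  ∀ f ∈ positiveCone F, S f ∈ positiveCone F

/-- `(Pₙ)` is an increasing sequence of positive operators converging strongly to the identity. -/
structure IsPositiveApproximation (P : ℕ → Complexification F →ₗ[ℂ] Complexification F) :
    Prop where
  positive : ∀ n, IsPositiveOperator (P n)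
  increasing : ∀ n, IsPositiveOperator (P (n + 1) - P n)
  tendsto_id : ∀ f, Tendsto (fun n => P n f) atTop (𝓝 f)

end Modulus

end Complexification

/-! ### Unbounded operators: spectrum, resolvent, poles, essential spectrum -/

namespace UnboundedOperator

variable {E : Type*} [NormedAddCommGroup E] [NormedSpace ℂ E]

/-- The map `l - A : D(A) → E`. -/
def scalarSub (A : E →ₗ.[ℂ] E) (l : ℂ) : A.domain →ₗ[ℂ] E :=
  l • A.domain.subtype - A.toFun

/-- `R` is a bounded everywhere defined two-sided inverse of `l - A : D(A) → E`. -/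
def IsResolventAt (A : E →ₗ.[ℂ] E) (l : ℂ) (R : E →L[ℂ] E) : Prop :=
  (∀ x : A.domain, R (scalarSub A l x) = x) ∧
    ∀ y : E, ∃ x : A.domain, (x : E) = R y ∧ scalarSub A l x = y

/-- The resolvent set of `A`. -/
def resolventSet (A : E →ₗ.[ℂ] E) : Set ℂ := {l | ∃ R, IsResolventAt A l R}

/-- The spectrum of `A`. -/
def spectrum (A : E →ₗ.[ℂ] E) : Set ℂ := (resolventSet A)ᶜ

open Classical in
/-- The resolvent `R(l, A) = (l - A)⁻¹` for `l` in the resolvent set (and `0` elsewhere). -/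
def resolvent (A : E →ₗ.[ℂ] E) (l : ℂ) : E →L[ℂ] E :=
  if h : ∃ R, IsResolventAt A l R then h.choose else 0

/-- `l₀` is a pole of order `k ≥ 1` of the resolvent of `A`: an isolated point of the spectrum
at which `R(·, A)` has a pole of order `k` in the operator norm. -/
def IsResolventPole (A : E →ₗ.[ℂ] E) (l₀ : ℂ) (k : ℕ) : Prop :=
  1 ≤ k ∧ l₀ ∈ spectrum A ∧ (∀ᶠ l in 𝓝[≠] l₀, l ∈ resolventSet A) ∧
    meromorphicOrderAt (resolvent A) l₀ = ((-(k : ℤ) : ℤ) : WithTop ℤ)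

/-- The spectral bound `s(A) ∈ [-∞, ∞]`. -/
def spectralBound (A : E →ₗ.[ℂ] E) : EReal := ⨆ l ∈ spectrum A, ((l.re : ℝ) : EReal)

/-- The peripheral spectrum: the spectral values with real part `s(A)`. -/
def peripheralSpectrum (A : E →ₗ.[ℂ] E) : Set ℂ :=
  {l ∈ spectrum A | ((l.re : ℝ) : EReal) = spectralBound A}

/-- `A - l` (equivalently `l - A`) is Fredholm: finite nullity and finite deficiency. -/
def IsFredholmAt (A : E →ₗ.[ℂ] E) (l : ℂ) : Prop :=
  FiniteDimensional ℂ (LinearMap.ker (scalarSub A l)) ∧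
    FiniteDimensional ℂ (E ⧸ LinearMap.range (scalarSub A l))

/-- The essential spectrum: the complement of the Fredholm domain. -/
def essentialSpectrum (A : E →ₗ.[ℂ] E) : Set ℂ := {l | ¬ IsFredholmAt A l}

/-- The essential spectral bound `s_ess(A) ∈ [-∞, ∞]`. -/
def essentialSpectralBound (A : E →ₗ.[ℂ] E) : EReal :=
  ⨆ l ∈ essentialSpectrum A, ((l.re : ℝ) : EReal)

end UnboundedOperator

/-! ### `C₀`-semigroups and local eventual positivity -/

/-- A `C₀`-semigroup on `E`; only the values at times `t ≥ 0` matter. -/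
structure C0Semigroup (E : Type*) [NormedAddCommGroup E] [NormedSpace ℂ E] where
  /-- the operator at time `t` -/
  op : ℝ → E →L[ℂ] E
  op_zero : op 0 = ContinuousLinearMap.id ℂ E
  op_add : ∀ s t : ℝ, 0 ≤ s → 0 ≤ t → op (s + t) = (op s).comp (op t)
  continuousOn_orbit : ∀ x : E, ContinuousOn (fun t => op t x) (Set.Ici 0)

namespace C0Semigroup

variable {E : Type*} [NormedAddCommGroup E] [NormedSpace ℂ E]

/-- `y = lim_{t ↓ 0} (T(t) x - x) / t`. -/
def HasDerivAtZero (T : C0Semigroup E) (x y : E) : Prop :=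
  Tendsto (fun t : ℝ => ((t : ℂ)⁻¹) • (T.op t x - x)) (𝓝[>] 0) (𝓝 y)

theorem HasDerivAtZero.unique {T : C0Semigroup E} {x y y' : E} (h : T.HasDerivAtZero x y)
    (h' : T.HasDerivAtZero x y') : y = y' := tendsto_nhds_unique h h'

theorem HasDerivAtZero.add {T : C0Semigroup E} {x y x' y' : E} (h : T.HasDerivAtZero x y)
    (h' : T.HasDerivAtZero x' y') : T.HasDerivAtZero (x + x') (y + y') := by
  refine (Tendsto.add h h').congr fun t => ?_
  rw [← smul_add, map_add]
  congr 1
  abel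

theorem HasDerivAtZero.smul {T : C0Semigroup E} {x y : E} (c : ℂ) (h : T.HasDerivAtZero x y) :
    T.HasDerivAtZero (c • x) (c • y) := by
  refine (Tendsto.const_smul h c).congr fun t => ?_
  rw [map_smul, ← smul_sub, smul_comm]

/-- The generator `A` of the semigroup: `A x = lim_{t ↓ 0} (T(t) x - x) / t`, with domain the set
of all `x` for which this limit exists. -/
def generator (T : C0Semigroup E) : E →ₗ.[ℂ] E where
  domain :=
    { carrier := {x | ∃ y, T.HasDerivAtZero x y}
      zero_mem' := ⟨0, by simp [HasDerivAtZero]⟩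
      add_mem' := by
        rintro x x' ⟨y, hy⟩ ⟨y', hy'⟩
        exact ⟨y + y', hy.add hy'⟩
      smul_mem' := by
        rintro c x ⟨y, hy⟩
        exact ⟨c • y, hy.smul c⟩ }
  toFun :=
    { toFun := fun x => x.2.choose
      map_add' := fun x x' =>
        (x + x').2.choose_spec.unique (x.2.choose_spec.add x'.2.choose_spec)
      map_smul' := fun c x => (c • x).2.choose_spec.unique (x.2.choose_spec.smul c) }

end C0Semigroup

/-- Local eventual positivity of `T` with respect to `(Pₙ)`: for all `n` and `0 ≠ f ∈ E₊` there is
`τ > 0` such that `Pₙ T(t) f ≥ 0` for all `t ≥ τ`. -/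
def HasLEP {F : Type*} [NormedAddCommGroup F] [Lattice F] [HasSolidNorm F] [IsOrderedAddMonoid F]
    [NormedSpace ℝ F] [IsOrderedModule ℝ F] [CompleteSpace F]
    (T : C0Semigroup (Complexification F))
    (P : ℕ → Complexification F →ₗ[ℂ] Complexification F) : Prop :=
  ∀ n : ℕ, ∀ f ∈ Complexification.positiveCone F, f ≠ 0 →
    ∃ τ : ℝ, 0 < τ ∧ ∀ t : ℝ, τ ≤ t → P n (T.op t f) ∈ Complexification.positiveCone F

end

open Filter Topology

noncomputable section

/-! ### Landau's theorem for Laplace transforms of positive measures -/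

section Landau

open MeasureTheory ProbabilityTheory
open scoped Nat

/-! Choose `α` strictly between the two bounds. Every point of the half-plane `Re z > α` is
Fredholm, and the half-plane meets the resolvent set, so the analytic Fredholm theorem makes the
resolvent meromorphic there. Every spectral value in that half-plane is then a pole
(`meromorphicAt_resolvent_of_isFredholmAt`, `exists_isResolventPole`).

Positivity enters through scalar orbits. For `f ≥ 0`, a positive functional `φ` and an index `n`,
replace `f` by `h = T(τ) f` with `τ` so large that `φ (Pₙ T(t) h) ≥ 0` for all `t ≥ 0`. Far to the
right, `φ (Pₙ R(z, A) h)` is the Laplace transform of a positive measure. By Landau's theorem such a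
transform converges up to its first real singularity, and it satisfies `|Lap z| ≤ Lap (Re z)`
(`exists_positive_laplace`). Thus real spectral values control the whole half-plane to their right.

The delay `τ` depends on `n` and `f`, but it is harmless at a pole `l`: if `Q` is the leading
Laurent coefficient, then `Q T(τ) f = exp (l τ) Q f` (`leading_coeff_op`). What is known about `φ
(Pₙ Q T(τ) f)` therefore passes to `φ (Pₙ Q f)` on dividing by a nonzero factor, which is positive
when `l` is real. Letting `n → ∞` and using that positive functionals determine the order yields
information on `Q` itself.

Three conclusions follow. A half-line `(a, ∞)` in the resolvent set, with the resolvent meromorphic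
on `Re z > a`, excludes all poles with real part above `a`; so `s(A)` must be spectral. The leading
coefficient at `s(A)` is positive and nonzero, and its range consists of eigenvectors. Finally,
`|Lap (l + ε)| ≤ Lap (s + ε)` on the line `Re l = s` forbids a pole of larger order than that of
`s`. -/

theorem isConnected_re_gt (a : ℝ) : IsConnected {z : ℂ | a < z.re} :=
  ⟨⟨((a + 1 : ℝ) : ℂ), by simp⟩, (convex_halfSpace_re_gt a).isPreconnected⟩

/-- Identity theorem for meromorphic functions on a half-plane. -/
theorem MeromorphicOn.eventuallyEq_of_re_gt {G L : ℂ → ℂ} {a x₀ : ℝ}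
    (hG : MeromorphicOn G {z | a < z.re}) (hL : MeromorphicOn L {z | a < z.re})
    (h : ∀ z : ℂ, x₀ < z.re → G z = L z) {z : ℂ} (hz : a < z.re) :
    G =ᶠ[𝓝[≠] z] L := by
  have hm : MeromorphicOn (G - L) {z | a < z.re} := hG.sub hL
  set y : ℂ := ((max a x₀ + 1 : ℝ) : ℂ) with hy
  have hyre : y.re = max a x₀ + 1 := by simp [hy]
  have hya : a < y.re := by rw [hyre]; linarith [le_max_left a x₀]
  have hyx : x₀ < y.re := by rw [hyre]; linarith [le_max_right a x₀]
  have htop : meromorphicOrderAt (G - L) y = ⊤ := by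
    rw [meromorphicOrderAt_eq_top_iff]
    have : ∀ᶠ w in 𝓝 y, x₀ < w.re :=
      (isOpen_lt continuous_const Complex.continuous_re).mem_nhds hyx
    filter_upwards [nhdsWithin_le_nhds this] with w hw
    simp [h w hw]
  have hz' : meromorphicOrderAt (G - L) z = ⊤ := by
    by_contra hne
    exact hm.meromorphicOrderAt_ne_top_of_isPreconnected (isConnected_re_gt a).isPreconnected
      hz hya hne htop
  rw [meromorphicOrderAt_eq_top_iff] at hz'
  filter_upwards [hz'] with w hw
  simpa [sub_eq_zero] using hw

variable {Ω : Type*} {m : MeasurableSpace Ω} {μ : Measure Ω} {X : Ω → ℝ}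

/-- If the Taylor series of the Laplace transform at `c` converges at `d < c`, then the Laplace
integral converges at `d`. -/
theorem mem_integrableExpSet_of_summable (hX : ∀ᵐ ω ∂μ, X ω ≤ 0) {c d : ℝ} (hdc : d ≤ c)
    (hc : c ∈ interior (integrableExpSet X μ))
    (hs : Summable fun n : ℕ => ((n ! : ℂ)⁻¹ • ((d : ℂ) - c) ^ n •
      iteratedDeriv n (complexMGF X μ) (c : ℂ))) :
    d ∈ integrableExpSet X μ := by
  -- Terms of the expansion of `exp (d X)` around `c`. As `d - c` and `X` are both nonpositive,
  -- every term is nonnegative, so integral and sum can be exchanged in `[0, ∞]`, and summability of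
  -- the Taylor series bounds the integral.
  set Fn : ℕ → Ω → ℝ := fun n ω => ((n ! : ℝ)⁻¹ * (d - c) ^ n) * (X ω ^ n * Real.exp (c * X ω))
    with hFn
  have hXm : AEMeasurable X μ := aemeasurable_of_mem_interior_integrableExpSet hc
  have hint : ∀ n, Integrable (Fn n) μ := fun n =>
    (integrable_pow_mul_exp_of_mem_interior_integrableExpSet hc n).const_mul _
  have hnn : ∀ n, 0 ≤ᵐ[μ] Fn n := fun n => by
    filter_upwards [hX] with ω hω
    have : Fn n ω = (n ! : ℝ)⁻¹ * ((d - c) * X ω) ^ n * Real.exp (c * X ω) := by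
      simp only [hFn]; rw [mul_pow]; ring
    rw [Pi.zero_apply, this]
    have h0 : 0 ≤ (d - c) * X ω := mul_nonneg_of_nonpos_of_nonpos (by linarith) hω
    positivity
  have hterm : ∀ n, ((n ! : ℂ)⁻¹ • ((d : ℂ) - c) ^ n •
      iteratedDeriv n (complexMGF X μ) (c : ℂ)) = ((∫ ω, Fn n ω ∂μ : ℝ) : ℂ) := fun n => by
    rw [iteratedDeriv_complexMGF (by simpa using hc), integral_const_mul, Complex.ofReal_mul,
      ← integral_complex_ofReal]
    simp only [smul_eq_mul]
    push_cast
    ring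
  have hsum : Summable fun n => ∫ ω, Fn n ω ∂μ := by
    simp_rw [hterm] at hs
    exact Complex.summable_ofReal.1 hs
  have hexp : ∀ᵐ ω ∂μ, ENNReal.ofReal (Real.exp (d * X ω)) = ∑' n, ENNReal.ofReal (Fn n ω) := by
    filter_upwards [ae_all_iff.2 hnn] with ω hω
    have h1 : HasSum (fun n => Fn n ω) (Real.exp (d * X ω)) := by
      have h2 : HasSum (fun n : ℕ => ((d - c) * X ω) ^ n / n !) (Real.exp ((d - c) * X ω)) := by
        rw [Real.exp_eq_exp_ℝ]
        exact NormedSpace.expSeries_div_hasSum_exp _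
      have h3 := h2.mul_right (Real.exp (c * X ω))
      rw [← Real.exp_add] at h3
      rw [show d * X ω = (d - c) * X ω + c * X ω by ring]
      have h4 : (fun n => Fn n ω) =
          fun n => ((d - c) * X ω) ^ n / n ! * Real.exp (c * X ω) := by
        funext n
        simp only [hFn]
        rw [mul_pow]
        ring
      rw [h4]
      exact h3
    rw [← h1.tsum_eq, ENNReal.ofReal_tsum_of_nonneg hω h1.summable]
  refine ⟨(Real.measurable_exp.comp_aemeasurable (hXm.const_mul d)).aestronglyMeasurable, ?_⟩
  rw [hasFiniteIntegral_iff_ofReal (ae_of_all _ fun ω => (Real.exp_pos _).le),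
    lintegral_congr_ae hexp,
    lintegral_tsum fun n => (hint n).1.aemeasurable.ennreal_ofReal]
  have : ∀ n, ∫⁻ ω, ENNReal.ofReal (Fn n ω) ∂μ = ENNReal.ofReal (∫ ω, Fn n ω ∂μ) := fun n =>
    (ofReal_integral_eq_lintegral_ofReal (hint n) (hnn n)).symm
  simp_rw [this]
  rw [← ENNReal.ofReal_tsum_of_nonneg (fun n => integral_nonneg_of_ae (hnn n)) hsum]
  exact ENNReal.ofReal_lt_top

/-- Landau's theorem: if the Laplace transform of a positive measure extends meromorphically to
`Re z > a` without poles on the real axis, then it converges for `Re z > a`. -/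
theorem Ioi_subset_integrableExpSet (hX : ∀ᵐ ω ∂μ, X ω ≤ 0) {H : ℂ → ℂ} {a x₀ : ℝ}
    (hH : MeromorphicOn H {z | a < z.re}) (hHa : ∀ x : ℝ, a < x → AnalyticAt ℂ H x)
    (hx₀ : Set.Ioi x₀ ⊆ integrableExpSet X μ)
    (hHX : ∀ z : ℂ, x₀ < z.re → H z = complexMGF X μ z) :
    Set.Ioi a ⊆ integrableExpSet X μ := by
  set S := integrableExpSet X μ with hS
  have hup : ∀ x ∈ S, ∀ y, x ≤ y → y ∈ S := fun x hx y hxy =>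
    convex_integrableExpSet.ordConnected.out hx
      (hx₀ (show max x₀ y + 1 ∈ Set.Ioi x₀ by
        simp only [Set.mem_Ioi]; linarith [le_max_left x₀ y]))
      ⟨hxy, by linarith [le_max_right x₀ y]⟩
  by_contra hcon
  obtain ⟨x₁, hx₁a, hx₁S⟩ := Set.not_subset.1 hcon
  rw [Set.mem_Ioi] at hx₁a
  have hbdd : BddBelow S := ⟨x₁, fun y hy => by
    by_contra h
    exact hx₁S (hup y hy x₁ (not_le.1 h).le)⟩
  have hne : S.Nonempty := ⟨x₀ + 1, hx₀ (by simp)⟩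
  set b := sInf S with hb
  have hx₁b : x₁ ≤ b := le_csInf hne fun y hy => by
    by_contra h
    exact hx₁S (hup y hy x₁ (not_le.1 h).le)
  have hba : a < b := hx₁a.trans_le hx₁b
  have hbS : Set.Ioi b ⊆ S := fun y hy => by
    obtain ⟨x, hx, hxy⟩ := (csInf_lt_iff hbdd hne).1 hy
    exact hup x hx y hxy.le
  obtain ⟨ε, hε, hball⟩ := Metric.eventually_nhds_iff_ball.1 (hHa b hba).eventually_analyticAt
  -- The disc of radius `ε / 2` around `c` lies in the disc of analyticity around the abscissa `b`,
  -- and it contains `d < b` because `c - d = 3ε / 8`. The Taylor series at `c` therefore converges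
  -- at `d`, which puts `d` into `S` below its infimum.
  set c := b + ε / 4 with hc
  set d := b - ε / 8 with hd
  have hcint : ∀ x, b < x → x ∈ interior S := fun x hx =>
    interior_maximal hbS isOpen_Ioi hx
  have hsub : Metric.ball (c : ℂ) (ε / 2) ⊆ Metric.ball (b : ℂ) ε := by
    refine Metric.ball_subset_ball' ?_
    rw [Complex.dist_eq, ← Complex.ofReal_sub, Complex.norm_real, hc, Real.norm_eq_abs,
      add_sub_cancel_left, abs_of_pos (by positivity)]
    linarith
  have hdiff : DifferentiableOn ℂ H (Metric.ball (c : ℂ) (ε / 2)) := fun z hz =>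
    (hball z (hsub hz)).differentiableAt.differentiableWithinAt
  have hdmem : (d : ℂ) ∈ Metric.ball (c : ℂ) (ε / 2) := by
    rw [Metric.mem_ball, Complex.dist_eq, ← Complex.ofReal_sub, Complex.norm_real, hc, hd,
      Real.norm_eq_abs, abs_lt]
    constructor <;> linarith
  have hser := (Complex.hasSum_taylorSeries_on_ball hdiff hdmem).summable
  have hbc : b < c := by rw [hc]; linarith
  have hana : ∀ z : ℂ, b < z.re → AnalyticAt ℂ (complexMGF X μ) z := fun z hz =>
    analyticAt_complexMGF (hcint _ hz)
  have heq : H =ᶠ[𝓝[≠] (c : ℂ)] complexMGF X μ :=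
    MeromorphicOn.eventuallyEq_of_re_gt (a := b) (x₀ := x₀)
      (fun z hz => hH z (hba.trans hz)) (fun z hz => (hana z hz).meromorphicAt) hHX
      (by simpa using hbc)
  have heq' : H =ᶠ[𝓝 (c : ℂ)] complexMGF X μ :=
    ((hHa c (hba.trans hbc)).frequently_eq_iff_eventually_eq
      (hana c (by simpa using hbc))).1 heq.frequently
  have hser' : Summable fun n : ℕ => ((n ! : ℂ)⁻¹ • ((d : ℂ) - c) ^ n •
      iteratedDeriv n (complexMGF X μ) (c : ℂ)) := by
    refine hser.congr fun n => ?_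
    rw [heq'.iteratedDeriv_eq n]
  have hdS : d ∈ S := mem_integrableExpSet_of_summable hX (by rw [hc, hd]; linarith)
    (hcint c hbc) hser'
  have := csInf_le hbdd hdS
  rw [← hb, hd] at this
  linarith

end Landau

/-! ### The analytic Fredholm theorem -/

section AnalyticFredholm

theorem AnalyticAt.matrix_det {n : Type*} [Fintype n] [DecidableEq n] {M : ℂ → Matrix n n ℂ}
    {l₀ : ℂ} (h : ∀ i j, AnalyticAt ℂ (fun l => M l i j) l₀) :
    AnalyticAt ℂ (fun l => (M l).det) l₀ := by
  simp only [Matrix.det_apply, Units.smul_def, zsmul_eq_mul]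
  exact Finset.analyticAt_fun_sum _ fun σ _ =>
    analyticAt_const.mul (Finset.analyticAt_fun_prod _ fun i _ => h _ _)

theorem AnalyticAt.matrix_adjugate {n : Type*} [Fintype n] [DecidableEq n] {M : ℂ → Matrix n n ℂ}
    {l₀ : ℂ} (h : ∀ i j, AnalyticAt ℂ (fun l => M l i j) l₀) (i j : n) :
    AnalyticAt ℂ (fun l => (M l).adjugate i j) l₀ := by
  simp only [Matrix.adjugate_apply]
  refine AnalyticAt.matrix_det fun i' j' => ?_
  simp only [Matrix.updateRow_apply]
  split_ifs
  · exact analyticAt_const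
  · exact h i' j'

/-- Cramer's rule for an analytic family of operators on a finite-dimensional space. -/
theorem exists_analyticAt_adjugate {C : Type*} [NormedAddCommGroup C] [NormedSpace ℂ C]
    [FiniteDimensional ℂ C] {W : ℂ → C →L[ℂ] C} {l₀ : ℂ} (hW : AnalyticAt ℂ W l₀) :
    ∃ (δ : ℂ → ℂ) (Z : ℂ → C →L[ℂ] C), AnalyticAt ℂ δ l₀ ∧ AnalyticAt ℂ Z l₀ ∧
      (∀ l, W l * Z l = δ l • 1) ∧ (∀ l, Z l * W l = δ l • 1) ∧ ∀ l, IsUnit (W l) → δ l ≠ 0 := by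
  classical
  let b := Module.finBasis ℂ C
  let e := LinearMap.toMatrixAlgEquiv b
  let M : ℂ → Matrix _ _ ℂ := fun l => e (W l : C →ₗ[ℂ] C)
  have hM : ∀ i j, AnalyticAt ℂ (fun l => M l i j) l₀ := fun i j => by
    have h1 : (fun l => M l i j) = fun l => ((LinearMap.toContinuousLinearMap (b.coord i)).comp
        (ContinuousLinearMap.apply ℂ C (b j))) (W l) := by
      funext l
      simp [M, e, LinearMap.toMatrixAlgEquiv_apply]
    rw [h1]
    exact (ContinuousLinearMap.analyticAt _ _).comp hW
  -- Writing the adjugate as a combination of fixed operators with scalar coefficients makes its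
  -- analyticity visible entrywise.
  let Z : ℂ → C →L[ℂ] C := fun l => ∑ i, ∑ j, (M l).adjugate i j •
    LinearMap.toContinuousLinearMap (e.symm (Matrix.single i j 1))
  have hZ : ∀ l, (Z l : C →ₗ[ℂ] C) = e.symm (M l).adjugate := fun l => by
    conv_rhs => rw [Matrix.matrix_eq_sum_single (M l).adjugate]
    simp only [map_sum]
    ext x
    simp only [Z, ContinuousLinearMap.coe_coe, _root_.sum_apply,
      _root_.smul_apply, LinearMap.coe_toContinuousLinearMap', LinearMap.sum_apply]
    refine Finset.sum_congr rfl fun i _ => Finset.sum_congr rfl fun j _ => ?_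
    rw [← LinearMap.smul_apply, ← map_smul, Matrix.smul_single, smul_eq_mul, mul_one]
  have hWe : ∀ l, (W l : C →ₗ[ℂ] C) = e.symm (M l) := fun l => (e.symm_apply_apply _).symm
  refine ⟨fun l => (M l).det, Z, AnalyticAt.matrix_det hM, ?_, fun l => ?_, fun l => ?_,
    fun l hl => ?_⟩
  · exact Finset.analyticAt_fun_sum _ fun i _ => Finset.analyticAt_fun_sum _ fun j _ =>
      (AnalyticAt.matrix_adjugate hM i j).smul analyticAt_const
  · apply ContinuousLinearMap.coe_injective
    change (W l : C →ₗ[ℂ] C) * (Z l : C →ₗ[ℂ] C) = (M l).det • (1 : C →ₗ[ℂ] C)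
    rw [hWe, hZ, ← map_mul, Matrix.mul_adjugate, map_smul, map_one]
  · apply ContinuousLinearMap.coe_injective
    change (Z l : C →ₗ[ℂ] C) * (W l : C →ₗ[ℂ] C) = (M l).det • (1 : C →ₗ[ℂ] C)
    rw [hWe, hZ, ← map_mul, Matrix.adjugate_mul, map_smul, map_one]
  · have h1 : IsUnit (W l : C →ₗ[ℂ] C) :=
      hl.map (ContinuousLinearMap.toLinearMapRingHom : (C →L[ℂ] C) →+* (C →ₗ[ℂ] C))
    have h2 : IsUnit (M l) := h1.map e
    exact ((Matrix.isUnit_iff_isUnit_det _).1 h2).ne_zero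

variable {X : Type*} [NormedAddCommGroup X] [NormedSpace ℂ X] [CompleteSpace X]

theorem AnalyticAt.ring_inverse {R : Type*} [NormedRing R] [NormedAlgebra ℂ R] [CompleteSpace R]
    {f : ℂ → R} {l : ℂ} (hf : AnalyticAt ℂ f l) (hu : IsUnit (f l)) :
    AnalyticAt ℂ (fun z => Ring.inverse (f z)) l := by
  obtain ⟨u, hu⟩ := hu
  exact AnalyticAt.fun_comp (g := Ring.inverse) (by rw [← hu]; exact analyticAt_inverse u) hf

theorem AnalyticAt.eventually_isUnit {R : Type*} [NormedRing R] [NormedAlgebra ℂ R]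
    [CompleteSpace R] {f : ℂ → R} {l : ℂ} (hf : AnalyticAt ℂ f l) (hu : IsUnit (f l)) :
    ∀ᶠ z in 𝓝 l, IsUnit (f z) := by
  have h : {x : R | IsUnit x} ∈ 𝓝 (f l) := Units.isOpen.mem_nhds (by simpa using hu)
  filter_upwards [hf.continuousAt h] with z hz
  simpa using hz

/-! ### Linear algebra of bordered (Grushin) problems -/

section Grushin

variable {C K : Type*} [AddCommGroup C] [Module ℂ C] [AddCommGroup K] [Module ℂ K]
  {Y : Type*} [AddCommGroup Y] [Module ℂ Y]
  {B : Y →ₗ[ℂ] Y} {i : C →ₗ[ℂ] Y} {p : Y →ₗ[ℂ] K} {N : Y × K →ₗ[ℂ] Y × C}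

/-- In an invertible Grushin problem, invertibility of the operator passes to the effective
Hamiltonian. -/
theorem grushin_bijective (hN : ∀ y k x c, N (y, k) = (x, c) ↔ B x + i c = y ∧ p x = k)
    (hB : Function.Bijective B) : Function.Bijective fun k => (N (0, k)).2 := by
  have hk : ∀ k, B (N (0, k)).1 + i (N (0, k)).2 = 0 ∧ p (N (0, k)).1 = k := fun k =>
    (hN 0 k _ _).1 rfl
  refine ⟨fun k k' h => ?_, fun c => ?_⟩
  · have h1 : B (N (0, k)).1 = B (N (0, k')).1 := by
      have e1 := (hk k).1
      have e2 := (hk k').1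
      simp only at h
      rw [h] at e1
      exact add_right_cancel (e1.trans e2.symm)
    rw [← (hk k).2, ← (hk k').2, hB.1 h1]
  · obtain ⟨x, hx⟩ := hB.2 (-i c)
    refine ⟨p x, ?_⟩
    simp only
    rw [(hN 0 (p x) x c).2 ⟨by rw [hx]; simp, rfl⟩]

/-- In an invertible Grushin problem, the inverse of the effective Hamiltonian gives the inverse
of the operator. -/
theorem grushin_inverse (hN : ∀ y k x c, N (y, k) = (x, c) ↔ B x + i c = y ∧ p x = k)
    {q : C →ₗ[ℂ] K} (hq : ∀ c, (N (0, q c)).2 = c) (hq' : ∀ k, q (N (0, k)).2 = k) (y : Y) :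
    B ((N (y, 0)).1 - (N (0, q (N (y, 0)).2)).1) = y ∧
      (N (B y, 0)).1 - (N (0, q (N (B y, 0)).2)).1 = y := by
  constructor
  · have h1 : B (N (y, 0)).1 + i (N (y, 0)).2 = y :=
      ((hN y 0 (N (y, 0)).1 (N (y, 0)).2).1 rfl).1
    have h2 : B (N (0, q (N (y, 0)).2)).1 + i (N (0, q (N (y, 0)).2)).2 = 0 :=
      ((hN 0 (q (N (y, 0)).2) (N (0, q (N (y, 0)).2)).1 (N (0, q (N (y, 0)).2)).2).1 rfl).1
    rw [hq] at h2
    rw [map_sub, eq_neg_of_add_eq_zero_left h2, sub_neg_eq_add, h1]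
  · have h1 : N (B y, p y) = (y, 0) := (hN _ _ _ _).2 ⟨by simp, rfl⟩
    have h2 : N (B y, p y) = N (B y, 0) + N (0, p y) := by rw [← map_add]; simp
    rw [h1] at h2
    have h3 : (N (B y, 0)).2 = -(N (0, p y)).2 := by
      have := congrArg Prod.snd h2
      simp only [Prod.snd_add] at this
      exact eq_neg_of_add_eq_zero_left this.symm
    have h4 : y = (N (B y, 0)).1 + (N (0, p y)).1 := congrArg Prod.fst h2
    rw [h3, map_neg, hq']
    have h5 : N (0, -p y) = -N (0, p y) := by
      rw [← N.map_neg]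
      congr 1
      ext <;> simp
    rw [h5, Prod.fst_neg, sub_neg_eq_add]
    exact h4.symm

end Grushin

section CompAnalytic

variable {V₁ V₂ V₃ V₄ : Type*} [NormedAddCommGroup V₁] [NormedSpace ℂ V₁]
  [NormedAddCommGroup V₂] [NormedSpace ℂ V₂] [NormedAddCommGroup V₃] [NormedSpace ℂ V₃]
  [NormedAddCommGroup V₄] [NormedSpace ℂ V₄]

theorem AnalyticAt.clm_comp {f : ℂ → V₂ →L[ℂ] V₃} {g : ℂ → V₁ →L[ℂ] V₂} {l : ℂ}
    (hf : AnalyticAt ℂ f l) (hg : AnalyticAt ℂ g l) :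
    AnalyticAt ℂ (fun z => (f z).comp (g z)) l :=
  ((ContinuousLinearMap.compL ℂ V₁ V₂ V₃).analyticAt_bilinear (f l, g l)).comp₂ hf hg

end CompAnalytic

/-- The local form of the analytic Fredholm theorem. -/
theorem analytic_fredholm_local {B : ℂ → X →L[ℂ] X} {l₀ : ℂ} (hB : AnalyticAt ℂ B l₀)
    (hker : FiniteDimensional ℂ (LinearMap.ker (B l₀ : X →ₗ[ℂ] X)))
    (hran : FiniteDimensional ℂ (X ⧸ LinearMap.range (B l₀ : X →ₗ[ℂ] X)))
    (hfreq : ∃ᶠ l in 𝓝[≠] l₀, IsUnit (B l)) :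
    (∀ᶠ l in 𝓝[≠] l₀, IsUnit (B l)) ∧ MeromorphicAt (fun l => Ring.inverse (B l)) l₀ := by
  set K := LinearMap.ker (B l₀ : X →ₗ[ℂ] X) with hK
  obtain ⟨C, hC⟩ := Submodule.exists_isCompl (LinearMap.range (B l₀ : X →ₗ[ℂ] X))
  have : FiniteDimensional ℂ C := (Submodule.quotientEquivOfIsCompl _ _ hC).finiteDimensional
  have : CompleteSpace C := FiniteDimensional.complete ℂ C
  have : CompleteSpace K := FiniteDimensional.complete ℂ K
  obtain ⟨p, hp⟩ := Submodule.ClosedComplemented.of_finiteDimensional K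
  -- The Grushin problem: `B l` is bordered by the inclusion of a complement `C` of the range of `B
  -- l₀` and by a projection `p` onto its kernel `K`. This repairs both defects, so `G l₀` is
  -- bijective.
  let G : ℂ → (X × C) →L[ℂ] (X × K) := fun l =>
    ((ContinuousLinearMap.inl ℂ X K).comp ((B l).comp (ContinuousLinearMap.fst ℂ X C))) +
      ((C.subtypeL.comp (ContinuousLinearMap.snd ℂ X C)).prod
        (p.comp (ContinuousLinearMap.fst ℂ X C)))
  have hGapp : ∀ l x c, G l (x, c) = (B l x + c, p x) := fun l x c => by
    simp [G]
  have hGa : AnalyticAt ℂ G l₀ :=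
    (analyticAt_const.clm_comp (hB.clm_comp analyticAt_const)).add analyticAt_const
  have hGinj : Function.Injective (G l₀) := by
    rw [injective_iff_map_eq_zero]
    rintro ⟨x, c⟩ h
    rw [hGapp, Prod.mk_eq_zero] at h
    have hc : (c : X) = 0 := by
      have h1 : (c : X) ∈ LinearMap.range (B l₀ : X →ₗ[ℂ] X) :=
        ⟨-x, by rw [map_neg]; exact neg_eq_of_add_eq_zero_right h.1⟩
      exact (Submodule.disjoint_def.1 hC.disjoint) _ h1 c.2
    have hx : x ∈ K := by
      rw [hK, LinearMap.mem_ker]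
      simpa [hc] using h.1
    have h2 := hp ⟨x, hx⟩
    rw [h.2] at h2
    have hx0 : x = 0 := (congrArg Subtype.val h2).symm
    ext <;> simp [hx0, hc]
  have hGsurj : Function.Surjective (G l₀) := by
    rintro ⟨y, k⟩
    obtain ⟨z, hz, c, hc, hzc⟩ := Submodule.mem_sup.1
      (show y ∈ LinearMap.range (B l₀ : X →ₗ[ℂ] X) ⊔ C by rw [hC.sup_eq_top]; trivial)
    obtain ⟨x, rfl⟩ := hz
    refine ⟨(x + (k - p x : K), ⟨c, hc⟩), ?_⟩
    have hk : B l₀ ((k - p x : K) : X) = 0 := LinearMap.mem_ker.1 (k - p x).2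
    rw [hGapp, map_add, map_add, hk, add_zero, hp]
    ext
    · exact hzc
    · simp
  let G₀ : (X × C) ≃L[ℂ] (X × K) := ContinuousLinearEquiv.ofBijective (G l₀)
    (LinearMap.ker_eq_bot.2 hGinj) (LinearMap.range_eq_top.2 hGsurj)
  let S : (X × K) →L[ℂ] (X × C) := G₀.symm
  have hSG : ∀ w, S (G l₀ w) = w := fun w => G₀.symm_apply_apply w
  have hGS : ∀ w, G l₀ (S w) = w := fun w => G₀.apply_symm_apply w
  -- Composing with the inverse of `G l₀` gives an endomorphism that is the identity at `l₀`, hence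
  -- invertible nearby; `N l` is then the inverse of `G l`.
  let M : ℂ → (X × C) →L[ℂ] (X × C) := fun l => S.comp (G l)
  have hMa : AnalyticAt ℂ M l₀ := analyticAt_const.clm_comp hGa
  have hM1 : M l₀ = 1 := by
    exact ContinuousLinearMap.ext hSG
  let N : ℂ → (X × K) →L[ℂ] (X × C) := fun l => (Ring.inverse (M l)).comp S
  have hM0 : IsUnit (M l₀) := by rw [hM1]; exact isUnit_one
  have hNa : AnalyticAt ℂ N l₀ := (hMa.ring_inverse hM0).clm_comp analyticAt_const
  have hMu : ∀ᶠ l in 𝓝 l₀, IsUnit (M l) :=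
    AnalyticAt.eventually_isUnit (R := (X × C) →L[ℂ] (X × C)) hMa hM0
  have hNiff : ∀ᶠ l in 𝓝 l₀, ∀ y k x c,
      N l (y, k) = (x, c) ↔ B l x + (c : X) = y ∧ p x = k := by
    filter_upwards [hMu] with l hl y k x c
    have h1 : N l (y, k) = (x, c) ↔ G l (x, c) = (y, k) := by
      constructor
      · intro h
        have h2 : M l (N l (y, k)) = S (y, k) := by
          have := DFunLike.congr_fun (Ring.mul_inverse_cancel (M l) hl) (S (y, k))
          exact this
        rw [h] at h2
        have h3 := congrArg (G l₀) h2
        rwa [hGS, show M l (x, c) = S (G l (x, c)) from rfl, hGS] at h3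
      · intro h
        rw [← h]
        exact DFunLike.congr_fun (Ring.inverse_mul_cancel (M l) hl) (x, c)
    rw [h1, hGapp, Prod.mk.injEq]
  let a : ℂ → X →L[ℂ] X := fun l =>
    (ContinuousLinearMap.fst ℂ X C).comp ((N l).comp (ContinuousLinearMap.inl ℂ X K))
  let b : ℂ → K →L[ℂ] X := fun l =>
    (ContinuousLinearMap.fst ℂ X C).comp ((N l).comp (ContinuousLinearMap.inr ℂ X K))
  let g : ℂ → X →L[ℂ] C := fun l =>
    (ContinuousLinearMap.snd ℂ X C).comp ((N l).comp (ContinuousLinearMap.inl ℂ X K))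
  let d : ℂ → K →L[ℂ] C := fun l =>
    (ContinuousLinearMap.snd ℂ X C).comp ((N l).comp (ContinuousLinearMap.inr ℂ X K))
  have haa : AnalyticAt ℂ a l₀ := analyticAt_const.clm_comp (hNa.clm_comp analyticAt_const)
  have hba : AnalyticAt ℂ b l₀ := analyticAt_const.clm_comp (hNa.clm_comp analyticAt_const)
  have hga : AnalyticAt ℂ g l₀ := analyticAt_const.clm_comp (hNa.clm_comp analyticAt_const)
  have hda : AnalyticAt ℂ d l₀ := analyticAt_const.clm_comp (hNa.clm_comp analyticAt_const)
  have hdbij : ∀ᶠ l in 𝓝 l₀, IsUnit (B l) → Function.Bijective (d l) := by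
    filter_upwards [hNiff] with l hl hu
    exact grushin_bijective (B := (B l : X →ₗ[ℂ] X)) (i := C.subtype) (p := (p : X →ₗ[ℂ] K))
      (N := (N l : (X × K) →ₗ[ℂ] (X × C))) hl (ContinuousLinearMap.isUnit_iff_bijective.1 hu)
  -- At one nearby point where `B` is invertible the effective Hamiltonian `d` identifies `K` with
  -- `C`. Through this fixed identification `d` becomes a family of endomorphisms of `C`, to which
  -- determinants apply.
  obtain ⟨l₁, hl₁, hl₁'⟩ :=
    (hfreq.and_eventually (nhdsWithin_le_nhds hdbij)).exists
  let e : K ≃L[ℂ] C :=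
    (LinearEquiv.ofBijective (d l₁ : K →ₗ[ℂ] C) (hl₁' hl₁)).toContinuousLinearEquiv
  let W : ℂ → C →L[ℂ] C := fun l => (d l).comp (e.symm : C →L[ℂ] K)
  obtain ⟨δ, Z, hδa, hZa, hWZ, hZW, hδu⟩ :=
    exists_analyticAt_adjugate (hda.clm_comp analyticAt_const : AnalyticAt ℂ W l₀)
  have hδne : ∀ᶠ l in 𝓝 l₀, IsUnit (B l) → δ l ≠ 0 := by
    filter_upwards [hdbij] with l hl hu
    refine hδu l (ContinuousLinearMap.isUnit_iff_bijective.2 ?_)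
    exact (hl hu).comp e.symm.bijective
  -- The analytic function `δ` cannot vanish identically near `l₀`, since points where `B` is
  -- invertible accumulate there; so its zeros are isolated.
  have hδ : ∀ᶠ l in 𝓝[≠] l₀, δ l ≠ 0 := by
    refine hδa.eventually_eq_zero_or_eventually_ne_zero.resolve_left fun h0 => ?_
    obtain ⟨l, hl, h1, h2⟩ := (hfreq.and_eventually
      (nhdsWithin_le_nhds (hδne.and h0))).exists
    exact h1 hl h2
  let q : ℂ → C →L[ℂ] K := fun l => (e.symm : C →L[ℂ] K).comp (Z l)
  -- The Schur complement formula `a - b d⁻¹ g`, with `d⁻¹ = δ⁻¹ q`; the only possible singularity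
  -- comes from the scalar `δ⁻¹`.
  let V : ℂ → X →L[ℂ] X := fun l => a l - (δ l)⁻¹ • (b l).comp ((q l).comp (g l))
  have hV : ∀ᶠ l in 𝓝[≠] l₀, B l * V l = 1 ∧ V l * B l = 1 := by
    filter_upwards [nhdsWithin_le_nhds hNiff, hδ] with l hl hl0
    have hq1 : ∀ c, d l (((δ l)⁻¹ • q l) c) = c := fun c => by
      have h1 := DFunLike.congr_fun (hWZ l) c
      have h2 : d l (q l c) = δ l • c := h1
      rw [_root_.smul_apply, map_smul, h2, smul_smul, inv_mul_cancel₀ hl0, one_smul]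
    have hq2 : ∀ k, ((δ l)⁻¹ • q l) (d l k) = k := fun k => by
      have h1 := DFunLike.congr_fun (hZW l) (e k)
      have h2 : Z l (d l k) = δ l • e k := by
        rw [← e.symm_apply_apply k]
        simpa using h1
      rw [_root_.smul_apply, show q l (d l k) = e.symm (Z l (d l k)) from rfl, h2, map_smul,
        e.symm_apply_apply, smul_smul, inv_mul_cancel₀ hl0, one_smul]
    have key := grushin_inverse (B := (B l : X →ₗ[ℂ] X)) (i := C.subtype)
      (p := (p : X →ₗ[ℂ] K)) (N := (N l : (X × K) →ₗ[ℂ] (X × C)))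
      (q := ((((δ l)⁻¹ • q l : C →L[ℂ] K)) : C →ₗ[ℂ] K)) hl hq1 hq2
    have hVapp : ∀ y, V l y = a l y - b l (((δ l)⁻¹ • q l) (g l y)) := fun y => by
      simp [V]
    constructor
    · ext y
      rw [mul_apply_eq_comp, hVapp]
      exact (key y).1
    · ext y
      rw [mul_apply_eq_comp, hVapp]
      exact (key y).2
  constructor
  · filter_upwards [hV] with l hl
    exact ⟨⟨B l, V l, hl.1, hl.2⟩, rfl⟩
  · have hVm : MeromorphicAt V l₀ :=
      haa.meromorphicAt.sub (hδa.meromorphicAt.inv.smul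
        (hba.clm_comp ((analyticAt_const.clm_comp hZa).clm_comp hga)).meromorphicAt)
    refine hVm.congr ?_
    filter_upwards [hV] with l hl
    exact (Ring.inverse_unit ⟨B l, V l, hl.1, hl.2⟩).symm

/-- The analytic Fredholm theorem: an analytic family of Fredholm operators on a connected open
set which is invertible at one point has a meromorphic inverse. -/
theorem analytic_fredholm {B : ℂ → X →L[ℂ] X} {U : Set ℂ} (hUc : IsPreconnected U)
    (hB : ∀ l ∈ U, AnalyticAt ℂ B l)
    (hker : ∀ l ∈ U, FiniteDimensional ℂ (LinearMap.ker (B l : X →ₗ[ℂ] X)))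
    (hran : ∀ l ∈ U, FiniteDimensional ℂ (X ⧸ LinearMap.range (B l : X →ₗ[ℂ] X)))
    (hinv : ∃ l ∈ U, IsUnit (B l)) {l : ℂ} (hl : l ∈ U) :
    (∀ᶠ z in 𝓝[≠] l, IsUnit (B z)) ∧ MeromorphicAt (fun z => Ring.inverse (B z)) l := by
  -- Connectedness argument: `V` is open, it meets `U` by `hinv`, and the local theorem shows that
  -- it is relatively closed in `U`.
  set V : Set ℂ := {z | ∀ᶠ w in 𝓝[≠] z, IsUnit (B w)} with hV
  have hVo : IsOpen V := by
    rw [isOpen_iff_mem_nhds]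
    intro z hz
    have h1 := eventually_eventually_nhdsWithin.2 hz
    have h2 : ∀ᶠ y in 𝓝[≠] z, y ∈ V := by
      filter_upwards [h1, self_mem_nhdsWithin] with y hy hyz
      rw [hV, Set.mem_ofPred_eq]
      rw [IsOpen.nhdsWithin_eq isOpen_compl_singleton hyz] at hy
      exact nhdsWithin_le_nhds hy
    rw [eventually_nhdsWithin_iff] at h2
    filter_upwards [h2] with y hy
    by_cases hyz : y = z
    · rw [hyz]; exact hz
    · exact hy hyz
  have hfreq : ∀ z ∈ closure V, ∃ᶠ w in 𝓝[≠] z, IsUnit (B w) := by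
    intro z hz hcon
    rw [eventually_nhdsWithin_iff] at hcon
    obtain ⟨O, hO, hOo, hzO⟩ := eventually_nhds_iff.1 hcon
    obtain ⟨v, hvO, hvV⟩ := mem_closure_iff.1 hz O hOo hzO
    have h1 : ∀ᶠ w in 𝓝[≠] v, w ∈ O := nhdsWithin_le_nhds (hOo.mem_nhds hvO)
    have h2 : ∀ᶠ w in 𝓝[≠] v, w ≠ z := by
      by_cases hvz : v = z
      · rw [hvz]; exact self_mem_nhdsWithin
      · exact nhdsWithin_le_nhds (isOpen_ne.mem_nhds hvz)
    obtain ⟨w, hw1, hw2, hw3⟩ := (h1.and (h2.and hvV)).exists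
    exact hO w hw1 hw2 hw3
  have hsub : U ⊆ V := by
    refine hUc.subset_of_closure_inter_subset hVo ?_ ?_
    · obtain ⟨z, hz, hzu⟩ := hinv
      exact ⟨z, hz, nhdsWithin_le_nhds
        ((hB z hz).eventually_isUnit hzu)⟩
    · rintro z ⟨hz, hzU⟩
      exact (analytic_fredholm_local (hB z hzU) (hker z hzU) (hran z hzU) (hfreq z hz)).1
  exact analytic_fredholm_local (hB l hl) (hker l hl) (hran l hl)
    (hfreq l (subset_closure (hsub hl)))

end AnalyticFredholm

/-! ### Resolvents of unbounded operators -/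

namespace UnboundedOperator

variable {E : Type*} [NormedAddCommGroup E] [NormedSpace ℂ E] {A : E →ₗ.[ℂ] E} {l μ : ℂ}
  {R R' S : E →L[ℂ] E}

theorem scalarSub_apply (A : E →ₗ.[ℂ] E) (l : ℂ) (x : A.domain) :
    scalarSub A l x = l • (x : E) - A x := rfl

theorem scalarSub_eq_add (A : E →ₗ.[ℂ] E) (l μ : ℂ) (x : A.domain) :
    scalarSub A l x = scalarSub A μ x + (l - μ) • (x : E) := by
  rw [scalarSub_apply, scalarSub_apply, sub_smul]
  abel

theorem IsResolventAt.unique (h : IsResolventAt A l R) (h' : IsResolventAt A l R') : R = R' := by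
  ext y
  obtain ⟨x, hx, hy⟩ := h.2 y
  rw [← hx, ← hy, h'.1 x]

theorem isResolventAt_resolvent (h : l ∈ resolventSet A) : IsResolventAt A l (resolvent A l) := by
  have h' : ∃ R, IsResolventAt A l R := h
  rw [resolvent, dif_pos h']
  exact h'.choose_spec

theorem IsResolventAt.mem (h : IsResolventAt A l R) : l ∈ resolventSet A := ⟨R, h⟩

theorem IsResolventAt.resolvent_eq (h : IsResolventAt A l R) : resolvent A l = R :=
  (isResolventAt_resolvent h.mem).unique h

theorem resolvent_eq_zero (h : l ∉ resolventSet A) : resolvent A l = 0 := dif_neg h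

/-- The factorization `l - A = (1 + (l - μ) R)(μ - A)`, with `μ - A` bijective onto `E`, transfers
invertibility and Fredholm properties from the unbounded family to a bounded analytic one. -/
theorem IsResolventAt.scalarSub_eq (h : IsResolventAt A μ R) (x : A.domain) :
    scalarSub A l x = (1 + (l - μ) • R) (scalarSub A μ x) := by
  rw [scalarSub_eq_add A l μ]
  simp [h.1 x]

theorem IsResolventAt.resolvent_identity (h : IsResolventAt A μ R) (h' : IsResolventAt A l R')
    (y : E) : R' y = R y - (l - μ) • R (R' y) := by
  obtain ⟨x, hx, hy⟩ := h'.2 y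
  rw [← hx]
  conv_rhs => rw [← hy, scalarSub_eq_add A l μ, map_add, h.1, map_smul]
  abel

theorem IsResolventAt.resolvent_identity' (h : IsResolventAt A μ R) (h' : IsResolventAt A l R')
    (y : E) : R' y = R y - (l - μ) • R' (R y) := by
  obtain ⟨x, hx, hy⟩ := h.2 y
  rw [← hx]
  have h1 := h'.1 x
  rw [scalarSub_eq_add A l μ, hy, map_add, map_smul] at h1
  exact eq_sub_of_add_eq h1

/-- The two resolvent identities characterize the resolvent. Being closed under limits, they serve
to recognize a limit of resolvents as a resolvent. -/
theorem IsResolventAt.of_identity (h : IsResolventAt A μ R)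
    (h1 : ∀ y, R' y = R y - (l - μ) • R (R' y)) (h2 : ∀ y, R' y = R y - (l - μ) • R' (R y)) :
    IsResolventAt A l R' := by
  constructor
  · intro x
    obtain hx := h.1 x
    rw [scalarSub_eq_add A l μ, map_add, map_smul, h2, hx]
    abel
  · intro y
    obtain ⟨x, hx, hy⟩ := h.2 (y - (l - μ) • R' y)
    have hx' : (x : E) = R' y := by
      rw [hx, map_sub, map_smul]
      exact (h1 y).symm
    refine ⟨x, hx', ?_⟩
    rw [scalarSub_eq_add A l μ, hy, hx']
    abel

section Complete

variable [CompleteSpace E]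

omit [CompleteSpace E] in
theorem IsResolventAt.of_isUnit (h : IsResolventAt A μ R) (hu : IsUnit (1 + (l - μ) • R)) :
    IsResolventAt A l (R * Ring.inverse (1 + (l - μ) • R)) := by
  have h1 := Ring.mul_inverse_cancel _ hu
  have h2 := Ring.inverse_mul_cancel _ hu
  constructor
  · intro x
    rw [h.scalarSub_eq]
    have h3 := DFunLike.congr_fun h2 (scalarSub A μ x)
    rw [mul_apply_eq_comp] at h3 ⊢
    rw [h3]
    exact h.1 x
  · intro y
    obtain ⟨x, hx, hy⟩ := h.2 (Ring.inverse (1 + (l - μ) • R) y)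
    refine ⟨x, hx, ?_⟩
    rw [h.scalarSub_eq, hy]
    exact DFunLike.congr_fun h1 y

theorem IsResolventAt.isUnit (h : IsResolventAt A μ R) (h' : IsResolventAt A l R') :
    IsUnit (1 + (l - μ) • R) := by
  rw [ContinuousLinearMap.isUnit_iff_bijective]
  constructor
  · rw [injective_iff_map_eq_zero]
    intro y hy
    obtain ⟨x, hx, rfl⟩ := h.2 y
    rw [← h.scalarSub_eq] at hy
    have h1 := h'.1 x
    rw [hy, map_zero] at h1
    have : x = 0 := Subtype.ext h1.symm
    rw [this, map_zero]
  · intro y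
    obtain ⟨x, -, hy⟩ := h'.2 y
    exact ⟨scalarSub A μ x, by rw [← h.scalarSub_eq, hy]⟩

theorem IsResolventAt.mem_iff (h : IsResolventAt A μ R) :
    l ∈ resolventSet A ↔ IsUnit (1 + (l - μ) • R) :=
  ⟨fun ⟨_, h'⟩ => h.isUnit h', fun hu => (h.of_isUnit hu).mem⟩

/-- The equality holds on all of `ℂ`: off the resolvent set both `resolvent` and `Ring.inverse` take
their default value zero. Analyticity and meromorphy can thus be read off the bounded family. -/
theorem IsResolventAt.resolvent_eq_mul (h : IsResolventAt A μ R) :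
    resolvent A = fun l => R * Ring.inverse (1 + (l - μ) • R) := by
  funext l
  by_cases hu : IsUnit (1 + (l - μ) • R)
  · exact (h.of_isUnit hu).resolvent_eq
  · rw [resolvent_eq_zero fun hl => hu (h.mem_iff.1 hl), Ring.inverse_non_unit _ hu, mul_zero]

omit [CompleteSpace E] in
theorem analyticAt_one_add_smul (R : E →L[ℂ] E) (μ l : ℂ) :
    AnalyticAt ℂ (fun z : ℂ => 1 + (z - μ) • R) l :=
  analyticAt_const.add ((analyticAt_id.sub analyticAt_const).smul analyticAt_const)

theorem isOpen_resolventSet (A : E →ₗ.[ℂ] E) : IsOpen (resolventSet A) := by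
  rw [isOpen_iff_mem_nhds]
  rintro l ⟨R, h⟩
  filter_upwards [(analyticAt_one_add_smul R l l).eventually_isUnit (by simp)] with z hz
  exact h.mem_iff.2 hz

theorem analyticAt_resolvent (hl : l ∈ resolventSet A) : AnalyticAt ℂ (resolvent A) l := by
  obtain ⟨R, h⟩ := hl
  rw [h.resolvent_eq_mul]
  exact analyticAt_const.mul ((analyticAt_one_add_smul R l l).ring_inverse (by simp))

/-- The analytic Fredholm theorem for resolvents: on a connected set of
Fredholm points which meets the resolvent set, the resolvent is meromorphic. -/
theorem meromorphicAt_resolvent_of_isFredholmAt {U : Set ℂ} (hU : IsPreconnected U)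
    (hF : ∀ z ∈ U, IsFredholmAt A z) (hμ : ∃ z ∈ U, z ∈ resolventSet A) (hl : l ∈ U) :
    (∀ᶠ z in 𝓝[≠] l, z ∈ resolventSet A) ∧ MeromorphicAt (resolvent A) l := by
  obtain ⟨μ, hμU, R, h⟩ := hμ
  have key := analytic_fredholm (B := fun z : ℂ => 1 + (z - μ) • R) hU
    (fun z _ => analyticAt_one_add_smul R μ z) (fun z hz => ?_) (fun z hz => ?_)
    ⟨μ, hμU, by simp⟩ hl
  · refine ⟨key.1.mono fun z hz => h.mem_iff.2 hz, ?_⟩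
    rw [h.resolvent_eq_mul]
    obtain ⟨n, hn⟩ := key.2
    refine ⟨n, (analyticAt_const (v := R)).clm_comp hn |>.congr (.of_forall fun z => ?_)⟩
    exact ContinuousLinearMap.comp_smul R _ _
  -- By the factorization, `μ - A` maps the kernel of `z - A` onto that of `1 + (z - μ) R`.
  · have := (hF z hz).1
    refine Submodule.finiteDimensional_of_le
      (S₂ := (LinearMap.ker (scalarSub A z)).map (scalarSub A μ)) fun y hy => ?_
    obtain ⟨x, hx, rfl⟩ := h.2 y
    refine ⟨x, ?_, rfl⟩
    have h1 : (1 + (z - μ) • R) (scalarSub A μ x) = 0 := hy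
    rw [← h.scalarSub_eq] at h1
    exact h1
  · have h1 : LinearMap.range ((1 + (z - μ) • R : E →L[ℂ] E) : E →ₗ[ℂ] E) =
        LinearMap.range (scalarSub A z) := by
      ext y
      constructor
      · rintro ⟨w, rfl⟩
        obtain ⟨x, -, rfl⟩ := h.2 w
        exact ⟨x, h.scalarSub_eq x⟩
      · rintro ⟨x, rfl⟩
        exact ⟨scalarSub A μ x, (h.scalarSub_eq x).symm⟩
    rw [h1]
    exact (hF z hz).2

end Complete

/-- A bounded limit of the resolvent at `l` forces `l` into the resolvent set. -/
theorem mem_resolventSet_of_tendsto (hl : ∀ᶠ z in 𝓝[≠] l, z ∈ resolventSet A)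
    (hR : Tendsto (resolvent A) (𝓝[≠] l) (𝓝 R')) : l ∈ resolventSet A := by
  obtain ⟨μ, hμ⟩ := hl.exists
  have h := isResolventAt_resolvent hμ
  have happ : ∀ y, Tendsto (fun z => resolvent A z y) (𝓝[≠] l) (𝓝 (R' y)) := fun y =>
    ((ContinuousLinearMap.apply ℂ E y).continuous.tendsto _).comp hR
  have hsub : Tendsto (fun z : ℂ => z - μ) (𝓝[≠] l) (𝓝 (l - μ)) :=
    ((continuous_id.sub continuous_const).tendsto l).mono_left nhdsWithin_le_nhds
  refine (h.of_identity (R' := R') (fun y => ?_) (fun y => ?_)).mem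
  · have h1 := (tendsto_const_nhds (x := resolvent A μ y)).sub
      (hsub.smul (((resolvent A μ).continuous.tendsto _).comp (happ y)))
    refine tendsto_nhds_unique ((happ y).congr' ?_) h1
    filter_upwards [hl] with z hz
    exact h.resolvent_identity (isResolventAt_resolvent hz) y
  · have h1 := (tendsto_const_nhds (x := resolvent A μ y)).sub
      (hsub.smul (happ (resolvent A μ y)))
    refine tendsto_nhds_unique ((happ y).congr' ?_) h1
    filter_upwards [hl] with z hz
    exact h.resolvent_identity' (isResolventAt_resolvent hz) y

/-- A nonnegative order would give the resolvent a limit at `l`, and that limit would invert `l -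
A`. -/
theorem exists_isResolventPole (hls : l ∈ spectrum A) (hl : ∀ᶠ z in 𝓝[≠] l, z ∈ resolventSet A)
    (hm : MeromorphicAt (resolvent A) l) : ∃ k, IsResolventPole A l k := by
  have hneg : meromorphicOrderAt (resolvent A) l < 0 := by
    by_contra hcon
    obtain ⟨R', hR'⟩ := tendsto_nhds_of_meromorphicOrderAt_nonneg hm (not_lt.1 hcon)
    exact hls (mem_resolventSet_of_tendsto hl hR')
  lift meromorphicOrderAt (resolvent A) l to ℤ using hneg.ne_top with n hn
  have hn0 : n < 0 := by exact_mod_cast hneg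
  refine ⟨(-n).toNat, by omega, hls, hl, ?_⟩
  rw [← hn]
  congr 1
  omega

/-- The leading coefficient of the Laurent expansion of the resolvent at a pole. -/
theorem IsResolventPole.exists_tendsto {k : ℕ} (h : IsResolventPole A l k) :
    ∃ Q : E →L[ℂ] E, Q ≠ 0 ∧
      Tendsto (fun z => (z - l) ^ k • resolvent A z) (𝓝[≠] l) (𝓝 Q) := by
  obtain ⟨hk, -, -, hord⟩ := h
  have hm : MeromorphicAt (resolvent A) l := by
    -- The order of a non-meromorphic function is `0` by convention, which is incompatible with `-k`
    -- for `k ≥ 1`.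
    by_contra hcon
    rw [meromorphicOrderAt_of_not_meromorphicAt hcon] at hord
    have : (0 : ℤ) = -(k : ℤ) := by exact_mod_cast hord
    omega
  obtain ⟨g, hg, hg0, hgeq⟩ := (meromorphicOrderAt_eq_int_iff hm).1 hord
  refine ⟨g l, hg0, (hg.continuousAt.tendsto.mono_left nhdsWithin_le_nhds).congr' ?_⟩
  filter_upwards [hgeq, self_mem_nhdsWithin] with z hz hzl
  have hzl' : z - l ≠ 0 := sub_ne_zero.2 hzl
  rw [hz, smul_smul, zpow_neg, zpow_natCast, mul_inv_cancel₀ (pow_ne_zero k hzl'), one_smul]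

/-! ### The leading Laurent coefficient at a pole -/

section Leading

variable {Q : E →L[ℂ] E} {k : ℕ}

theorem tendsto_smul_resolvent_apply
    (hQ : Tendsto (fun z => (z - l) ^ k • resolvent A z) (𝓝[≠] l) (𝓝 Q)) (f : E) :
    Tendsto (fun z => (z - l) ^ k • resolvent A z f) (𝓝[≠] l) (𝓝 (Q f)) :=
  ((ContinuousLinearMap.apply ℂ E f).continuous.tendsto _).comp hQ

/-- The range of the leading coefficient at a pole consists of eigenvectors. -/
theorem IsResolventPole.exists_eigenvector (h : IsResolventPole A l k)
    (hQ : Tendsto (fun z => (z - l) ^ k • resolvent A z) (𝓝[≠] l) (𝓝 Q)) (f : E) :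
    ∃ v : A.domain, (v : E) = Q f ∧ A v = l • Q f := by
  obtain ⟨hk, -, hl, -⟩ := h
  obtain ⟨μ, hμ⟩ := hl.exists
  have hR := isResolventAt_resolvent hμ
  set R := resolvent A μ
  have happ := tendsto_smul_resolvent_apply hQ f
  have hsub : ∀ w : ℂ, Tendsto (fun z : ℂ => z - w) (𝓝[≠] l) (𝓝 (l - w)) := fun w =>
    ((continuous_id.sub continuous_const).tendsto l).mono_left nhdsWithin_le_nhds
  have hpow : Tendsto (fun z : ℂ => (z - l) ^ k • R f) (𝓝[≠] l) (𝓝 0) := by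
    have := ((hsub l).pow k).smul_const (R f)
    rwa [sub_self, zero_pow (by omega), zero_smul] at this
  have h1 := hpow.sub ((hsub μ).smul ((R.continuous.tendsto _).comp happ))
  -- Limit of the resolvent identity multiplied by `(z - l) ^ k`. It puts `Q f` into the range of
  -- `R`, that is, into the domain.
  have h2 : Q f = 0 - (l - μ) • R (Q f) := by
    refine tendsto_nhds_unique (happ.congr' ?_) h1
    filter_upwards [hl] with z hz
    rw [Function.comp_apply, map_smul]
    conv_lhs => rw [hR.resolvent_identity (isResolventAt_resolvent hz) f, smul_sub]
    rw [smul_comm (z - μ)]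
  obtain ⟨v, hv, hv'⟩ := hR.2 (-((l - μ) • Q f))
  have hvQ : (v : E) = Q f := by
    rw [hv, map_neg, map_smul, ← zero_sub]
    exact h2.symm
  refine ⟨v, hvQ, ?_⟩
  rw [scalarSub_apply, hvQ, sub_eq_iff_eq_add] at hv'
  have h3 : A v = μ • Q f + (l - μ) • Q f := by
    rw [hv']
    abel
  rw [h3, ← add_smul, add_sub_cancel]

theorem commute_leading_coeff (hl : ∀ᶠ z in 𝓝[≠] l, z ∈ resolventSet A)
    (hQ : Tendsto (fun z => (z - l) ^ k • resolvent A z) (𝓝[≠] l) (𝓝 Q))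
    (hS : ∀ z ∈ resolventSet A, ∀ f, resolvent A z (S f) = S (resolvent A z f)) (f : E) :
    Q (S f) = S (Q f) := by
  refine tendsto_nhds_unique (tendsto_smul_resolvent_apply hQ (S f))
    ((((S.continuous.tendsto _).comp (tendsto_smul_resolvent_apply hQ f))).congr' ?_)
  filter_upwards [hl] with z hz
  rw [Function.comp_apply, map_smul, hS z hz]

end Leading

end UnboundedOperator

/-! ### Generators and the Laplace transform of a semigroup -/

namespace C0Semigroup

open MeasureTheory UnboundedOperator

variable {E : Type*} [NormedAddCommGroup E] [NormedSpace ℂ E] (T : C0Semigroup E)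

theorem hasDerivAtZero_generator (x : T.generator.domain) :
    T.HasDerivAtZero (x : E) (T.generator x) :=
  x.2.choose_spec

variable {T} in
theorem HasDerivAtZero.exists_generator {x y : E} (h : T.HasDerivAtZero x y) :
    ∃ v : T.generator.domain, (v : E) = x ∧ T.generator v = y :=
  ⟨⟨x, y, h⟩, rfl, (T.hasDerivAtZero_generator ⟨x, y, h⟩).unique h⟩

theorem op_comm {s t : ℝ} (hs : 0 ≤ s) (ht : 0 ≤ t) (x : E) :
    T.op s (T.op t x) = T.op t (T.op s x) := by
  have h1 := DFunLike.congr_fun (T.op_add s t hs ht) x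
  have h2 := DFunLike.congr_fun (T.op_add t s ht hs) x
  rw [add_comm] at h2
  exact h1.symm.trans h2

theorem op_add_apply {s t : ℝ} (hs : 0 ≤ s) (ht : 0 ≤ t) (x : E) :
    T.op (s + t) x = T.op s (T.op t x) :=
  DFunLike.congr_fun (T.op_add s t hs ht) x

theorem op_zero_apply (x : E) : T.op 0 x = x := by
  rw [T.op_zero]
  rfl

variable {T} in
theorem HasDerivAtZero.op {x y : E} (h : T.HasDerivAtZero x y) {t : ℝ} (ht : 0 ≤ t) :
    T.HasDerivAtZero (T.op t x) (T.op t y) := by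
  refine (((T.op t).continuous.tendsto _).comp h).congr' ?_
  filter_upwards [self_mem_nhdsWithin] with s hs
  rw [Function.comp_apply, map_smul, map_sub, T.op_comm ht (le_of_lt hs)]

/-- The resolvent of the generator commutes with the semigroup. -/
theorem resolvent_op_comm {z : ℂ} (hz : z ∈ resolventSet T.generator) {t : ℝ} (ht : 0 ≤ t)
    (f : E) : resolvent T.generator z (T.op t f) = T.op t (resolvent T.generator z f) := by
  have hR := isResolventAt_resolvent hz
  obtain ⟨x, hx, hxf⟩ := hR.2 f
  obtain ⟨v, hv, hv'⟩ := ((T.hasDerivAtZero_generator x).op ht).exists_generator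
  have h1 : scalarSub T.generator z v = T.op t f := by
    rw [scalarSub_apply, hv, hv', ← hxf, scalarSub_apply, map_sub, map_smul]
  rw [← h1, hR.1, hv, hx]

/-- The orbit of `x`, extended to negative times by the constant `x`, is continuous. -/
theorem continuous_orbit (x : E) : Continuous fun t => T.op (max t 0) x :=
  (T.continuousOn_orbit x).comp_continuous (continuous_id.max continuous_const)
    fun t => Set.mem_Ici.2 (le_max_right t 0)

/-- An eigenvector of the generator is an eigenvector of the semigroup. -/
theorem op_eigenvector {l : ℂ} {v : T.generator.domain} (hv : T.generator v = l • (v : E))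
    {t : ℝ} (ht : 0 ≤ t) : T.op t v = Complex.exp (l * t) • (v : E) := by
  have hD := T.hasDerivAtZero_generator v
  rw [hv] at hD
  have h0 : HasDerivWithinAt (fun s : ℝ => T.op s v) (l • (v : E)) (Set.Ici 0) 0 := by
    rw [← hasDerivWithinAt_Ioi_iff_Ici, hasDerivWithinAt_iff_tendsto_slope' (by simp)]
    refine Tendsto.congr (fun s => ?_) hD
    rw [slope_def_module, T.op_zero_apply, sub_zero, ← Complex.ofReal_inv, Complex.coe_smul]
  have hexp : ∀ c : ℂ, ∀ s : ℝ, HasDerivAt (fun s : ℝ => Complex.exp (c * s))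
      (Complex.exp (c * s) * c) s := fun c s => by
    have h1 : HasDerivAt (fun s : ℝ => c * (s : ℂ)) (c * 1) s :=
      (Complex.ofRealCLM.hasDerivAt (x := s)).const_mul c
    rw [mul_one] at h1
    exact h1.cexp
  -- The rescaled orbit `exp (-l s) T(s) v` has right derivative zero at `0`; the semigroup law
  -- carries this to every later time, so the rescaled orbit is constant.
  have hφ : HasDerivWithinAt (fun s : ℝ => Complex.exp (-l * s) • T.op s v) 0 (Set.Ici 0) 0 := by
    have h1 : HasDerivWithinAt (fun s : ℝ => Complex.exp (-l * s) • T.op s v)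
        (Complex.exp (-l * (0 : ℝ)) • l • (v : E) +
          (Complex.exp (-l * (0 : ℝ)) * -l) • T.op 0 v) (Set.Ici 0) 0 :=
      (hexp (-l) 0).hasDerivWithinAt.smul h0
    convert! h1 using 1
    simp [T.op_zero_apply]
  have hw : ∀ x ∈ Set.Icc 0 t, Complex.exp (-l * x) • T.op x v =
      Complex.exp (-l * (0 : ℝ)) • T.op 0 v := by
    refine constant_of_has_deriv_right_zero (f := fun x : ℝ => Complex.exp (-l * x) • T.op x v)
      ?_ fun x hx => ?_
    · refine ContinuousOn.smul (by fun_prop) ((T.continuousOn_orbit v).mono ?_)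
      exact Set.Icc_subset_Ici_self
    · have hshift : HasDerivWithinAt (fun y : ℝ => y - x) 1 (Set.Ici x) x :=
        ((hasDerivAt_id x).sub_const x).hasDerivWithinAt
      have h1 : HasDerivWithinAt (fun y : ℝ =>
          Complex.exp (-l * (y - x : ℝ)) • T.op (y - x) v) 0 (Set.Ici x) x := by
        have := HasDerivWithinAt.scomp_of_eq x (t' := Set.Ici (0 : ℝ)) hφ hshift
          (fun y hy => by simpa using hy) (by simp)
        rw [smul_zero] at this
        exact this
      have h2 := ((T.op x).restrictScalars ℝ).hasFDerivAt.comp_hasDerivWithinAt x h1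
      have h3 := h2.const_smul (Complex.exp (-l * x))
      simp only [map_zero, smul_zero] at h3
      refine h3.congr (fun y hy => ?_) ?_
      · simp only [Pi.smul_apply, Function.comp_apply, ContinuousLinearMap.coe_restrictScalars',
          map_smul]
        rw [← T.op_add_apply hx.1 (sub_nonneg.2 hy), smul_smul, ← Complex.exp_add,
          add_sub_cancel]
        congr 2
        push_cast
        ring
      · simp [T.op_zero_apply]
  have h1 := hw t ⟨ht, le_rfl⟩
  simp only [Complex.ofReal_zero, mul_zero, Complex.exp_zero, one_smul, T.op_zero_apply] at h1
  conv_rhs => rw [← h1, smul_smul, ← Complex.exp_add]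
  simp

variable [CompleteSpace E]

/-- Uniform boundedness controls the operators on `[0, 1]`; splitting `t` into integer and
fractional parts gives `M ^ (⌊t⌋ + 1)`, with growth rate `log M`. Taking `M ≥ 1` keeps this rate
nonnegative. -/
theorem exists_exp_bound : ∃ M ω : ℝ, 0 ≤ M ∧ ∀ t, 0 ≤ t → ‖T.op t‖ ≤ M * Real.exp (ω * t) := by
  obtain ⟨M₀, hM₀⟩ := banach_steinhaus (g := fun t : Set.Icc (0 : ℝ) 1 => T.op t) fun x => by
    obtain ⟨C, hC⟩ := isCompact_Icc.exists_bound_of_continuousOn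
      ((T.continuousOn_orbit x).mono 
        (show Set.Icc (0 : ℝ) 1 ⊆ Set.Ici 0 from Set.Icc_subset_Ici_self))
    exact ⟨C, fun t => hC t t.2⟩
  set M := max M₀ 1 with hM
  have hM1 : 1 ≤ M := le_max_right _ _
  have hM0 : 0 < M := by linarith
  have hbd : ∀ t, 0 ≤ t → t ≤ 1 → ‖T.op t‖ ≤ M := fun t h0 h1 =>
    (hM₀ ⟨t, h0, h1⟩).trans (le_max_left _ _)
  have hind : ∀ n : ℕ, ∀ t, 0 ≤ t → t ≤ 1 → ‖T.op (n + t)‖ ≤ M ^ (n + 1) := by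
    intro n
    induction n with
    | zero => intro t h0 h1; simpa using hbd t h0 h1
    | succ n ih =>
      intro t h0 h1
      have h2 : ((n + 1 : ℕ) : ℝ) + t = 1 + (n + t) := by push_cast; ring
      rw [h2, T.op_add 1 (n + t) zero_le_one (by positivity)]
      calc _ ≤ ‖T.op 1‖ * ‖T.op (n + t)‖ := ContinuousLinearMap.opNorm_comp_le _ _
        _ ≤ M * M ^ (n + 1) := by
          gcongr
          · exact hbd 1 zero_le_one le_rfl
          · exact ih t h0 h1
        _ = _ := by ring
  refine ⟨M, Real.log M, hM0.le, fun t ht => ?_⟩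
  have h1 := hind ⌊t⌋₊ (t - ⌊t⌋₊) (by linarith [Nat.floor_le ht]) (by linarith [Nat.lt_floor_add_one t])
  rw [add_sub_cancel] at h1
  refine h1.trans ?_
  rw [pow_succ, mul_comm, ← Real.rpow_natCast, Real.rpow_def_of_pos hM0]
  gcongr
  · exact Real.log_nonneg hM1
  · exact Nat.floor_le ht

/-- For `Re z` large, the Laplace transform of the semigroup is the resolvent of its generator. -/
theorem exists_laplace : ∃ ω : ℝ, ∀ z : ℂ, ω < z.re → z ∈ resolventSet T.generator ∧ ∀ f : E,
    IntegrableOn (fun t : ℝ => Complex.exp (-z * t) • T.op (max t 0) f) (Set.Ioi 0) ∧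
    resolvent T.generator z f =
      ∫ t in Set.Ioi (0 : ℝ), Complex.exp (-z * t) • T.op (max t 0) f := by
  obtain ⟨M, ω, hM, hbd⟩ := T.exists_exp_bound
  refine ⟨ω, fun z hz => ?_⟩
  set u : E → ℝ → E := fun f t => Complex.exp (-z * t) • T.op (max t 0) f with hu
  have hucont : ∀ f, Continuous (u f) := fun f =>
    (by fun_prop : Continuous fun t : ℝ => Complex.exp (-z * t)).smul (T.continuous_orbit f)
  have hexpint : IntegrableOn (fun t => Real.exp (-(z.re - ω) * t)) (Set.Ioi 0) :=
    exp_neg_integrableOn_Ioi 0 (sub_pos.2 hz)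
  have hunorm : ∀ f, ∀ t ∈ Set.Ioi (0 : ℝ), ‖u f t‖ ≤
      M * ‖f‖ * Real.exp (-(z.re - ω) * t) := fun f t ht => by
    have ht0 : (0 : ℝ) ≤ t := le_of_lt ht
    simp only [hu]
    rw [norm_smul, Complex.norm_exp, max_eq_left ht0]
    have h1 : (-z * (t : ℂ)).re = -z.re * t := by simp
    rw [h1]
    calc _ ≤ Real.exp (-z.re * t) * (M * Real.exp (ω * t) * ‖f‖) := by
          gcongr
          exact (T.op t).le_of_opNorm_le (hbd t ht0) f
      _ = M * ‖f‖ * (Real.exp (-z.re * t) * Real.exp (ω * t)) := by ring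
      _ = _ := by rw [← Real.exp_add]; congr 2; ring
  have huint : ∀ f, IntegrableOn (u f) (Set.Ioi 0) := fun f =>
    Integrable.mono' (hexpint.const_mul (M * ‖f‖)) (hucont f).aestronglyMeasurable
      ((ae_restrict_iff' measurableSet_Ioi).2 (ae_of_all _ (hunorm f)))
  let R : E →L[ℂ] E := LinearMap.mkContinuous
    { toFun := fun f => ∫ t in Set.Ioi (0 : ℝ), u f t
      map_add' := fun f g => by
        rw [← integral_add (huint f) (huint g)]
        simp [hu]
      map_smul' := fun c f => by
        rw [RingHom.id_apply, ← integral_smul]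
        refine integral_congr_ae (ae_of_all _ fun t => ?_)
        simp only [hu, map_smul]
        rw [smul_comm] }
    (M * ∫ t in Set.Ioi (0 : ℝ), Real.exp (-(z.re - ω) * t)) (fun f => by
      have h1 := norm_integral_le_of_norm_le (hexpint.const_mul (M * ‖f‖))
        ((ae_restrict_iff' measurableSet_Ioi).2 (ae_of_all _ (hunorm f)))
      rw [integral_const_mul] at h1
      refine h1.trans_eq ?_
      ring)
  have hRapp : ∀ f, R f = ∫ t in Set.Ioi (0 : ℝ), u f t := fun f => rfl
  have hRcomm : ∀ s, 0 ≤ s → ∀ f, T.op s (R f) = R (T.op s f) := fun s hs f => by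
    rw [hRapp, hRapp, ← ContinuousLinearMap.integral_comp_comm _ (huint f)]
    refine integral_congr_ae (ae_of_all _ fun t => ?_)
    simp only [hu, map_smul]
    rw [T.op_comm hs (le_max_right _ _)]
  -- Translating the Laplace integral by `s` only removes its initial piece and contributes a factor
  -- `exp (z s)`. Differentiating this at `s = 0` shows that `R f` lies in the domain and that `(z -
  -- A) R f = f`.
  have hshift : ∀ s, 0 ≤ s → ∀ f, T.op s (R f) =
      Complex.exp (z * s) • (R f - ∫ t in (0 : ℝ)..s, u f t) := fun s hs f => by
    have h1 : ∫ t in Set.Ioi (0 : ℝ), u f (t + s) = ∫ t in Set.Ioi s, u f t := by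
      have := (measurePreserving_add_right volume s).setIntegral_preimage_emb
        (MeasurableEquiv.addRight s).measurableEmbedding (u f) (Set.Ioi s)
      rw [← this]
      congr 2
      ext t
      simp
    rw [hRapp, ← intervalIntegral.integral_Ioi_sub_Ioi (huint f) hs, sub_sub_cancel, ← h1,
      ← ContinuousLinearMap.integral_comp_comm _ (huint f), ← integral_smul]
    refine setIntegral_congr_fun measurableSet_Ioi fun t ht => ?_
    have ht0 : (0 : ℝ) ≤ t := le_of_lt ht
    simp only [hu, map_smul]
    rw [max_eq_left ht0, max_eq_left (by linarith : 0 ≤ t + s), ← T.op_add_apply hs ht0,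
      smul_smul, ← Complex.exp_add, add_comm s t]
    congr 2
    push_cast
    ring
  have hRderiv : ∀ f, T.HasDerivAtZero (R f) (z • R f - f) := fun f => by
    have h1 : HasDerivAt (fun s : ℝ => Complex.exp (z * s)) (Complex.exp (z * (0 : ℝ)) * z) 0 := by
      have h2 : HasDerivAt (fun s : ℝ => z * (s : ℂ)) (z * 1) 0 :=
        (Complex.ofRealCLM.hasDerivAt (x := 0)).const_mul z
      rw [mul_one] at h2
      exact h2.cexp
    have h3 : HasDerivAt (fun s : ℝ => R f - ∫ t in (0 : ℝ)..s, u f t) (-(u f 0)) 0 := by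
      have := ((hucont f).integral_hasStrictDerivAt 0 0).hasDerivAt.const_sub (R f)
      exact this
    have h4 := h1.smul h3
    have h5 := (hasDerivAt_iff_tendsto_slope_zero.1 h4).mono_left
      (nhdsWithin_mono (0 : ℝ) (fun x (hx : 0 < x) => (ne_of_gt hx : x ≠ 0)))
    have h6 : Complex.exp (z * (0 : ℝ)) • -(u f 0) + (Complex.exp (z * (0 : ℝ)) * z) •
        (R f - ∫ t in (0 : ℝ)..0, u f t) = z • R f - f := by
      simp [hu, T.op_zero_apply]
      abel
    rw [h6] at h5
    refine h5.congr' ?_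
    filter_upwards [self_mem_nhdsWithin] with s hs
    rw [hshift s (le_of_lt hs), ← Complex.ofReal_inv, Complex.coe_smul]
    simp
  have hres : IsResolventAt T.generator z R := by
    constructor
    · intro x
      have h1 : T.HasDerivAtZero (R x) (R (T.generator x)) := by
        refine (((R.continuous.tendsto _).comp (T.hasDerivAtZero_generator x))).congr' ?_
        filter_upwards [self_mem_nhdsWithin] with s hs
        rw [Function.comp_apply, map_smul, map_sub, hRcomm s (le_of_lt hs)]
      have h2 := h1.unique (hRderiv x)
      rw [scalarSub_apply, map_sub, map_smul, h2, sub_sub_cancel]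
    · intro y
      obtain ⟨v, hv, hv'⟩ := (hRderiv y).exists_generator
      refine ⟨v, hv, ?_⟩
      rw [scalarSub_apply, hv, hv', sub_sub_cancel]
  exact ⟨hres.mem, fun f => ⟨huint f, by rw [hres.resolvent_eq]; rfl⟩⟩

end C0Semigroup

/-! ### Landau's theorem for positive scalar orbits -/

namespace C0Semigroup

open MeasureTheory UnboundedOperator ProbabilityTheory

variable {E : Type*} [NormedAddCommGroup E] [NormedSpace ℂ E] (T : C0Semigroup E) [CompleteSpace E]

/-- If the scalar orbit `Ψ (T(t) h)` is positive and the resolvent is meromorphic for `Re z > a`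
without real poles there, then `Ψ (R(z, A) h)` is the Laplace transform of this orbit for all
`Re z > a`; in particular it is continuous there and dominated by its values on the real axis. -/
theorem exists_positive_laplace (Ψ : E →L[ℂ] ℂ) (h : E)
    (hpos : ∀ t, 0 ≤ t → 0 ≤ (Ψ (T.op t h)).re ∧ (Ψ (T.op t h)).im = 0) {a : ℝ}
    (hmero : ∀ z : ℂ, a < z.re → MeromorphicAt (resolvent T.generator) z)
    (hreal : ∀ x : ℝ, a < x → (x : ℂ) ∈ resolventSet T.generator) :
    ∃ Lap : ℂ → ℂ, (∀ z : ℂ, a < z.re → ContinuousAt Lap z) ∧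
      (∀ z : ℂ, a < z.re → z ∈ resolventSet T.generator →
        Ψ (resolvent T.generator z h) = Lap z) ∧
      (∀ z : ℂ, ‖Lap z‖ ≤ (Lap (z.re : ℂ)).re) ∧ ∀ x : ℝ, (Lap (x : ℂ)).im = 0 := by
  obtain ⟨ω, hω⟩ := T.exists_laplace
  set p : ℝ → NNReal := fun t => Real.toNNReal (Ψ (T.op (max t 0) h)).re with hp
  have hpm : Measurable p := (continuous_real_toNNReal.comp
    (Complex.continuous_re.comp (Ψ.continuous.comp (T.continuous_orbit h)))).measurable
  have hpΨ : ∀ t, ((p t : ℝ) : ℂ) = Ψ (T.op (max t 0) h) := fun t => by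
    obtain ⟨h1, h2⟩ := hpos (max t 0) (le_max_right _ _)
    rw [hp, Real.coe_toNNReal _ h1]
    exact Complex.ext rfl h2.symm
  -- With the orbit as density and `X t = -t`, the complex moment generating function of `X` is the
  -- Laplace transform of the orbit.
  set μ : Measure ℝ := (volume.restrict (Set.Ioi 0)).withDensity (fun t => (p t : ENNReal)) with hμ
  set X : ℝ → ℝ := fun t => -t with hX
  have hXμ : ∀ᵐ t ∂μ, X t ≤ 0 :=
    (withDensity_absolutelyContinuous _ _).ae_le ((ae_restrict_iff' measurableSet_Ioi).2
      (ae_of_all _ fun t ht => neg_nonpos.2 (le_of_lt ht)))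
  have hexp : ∀ (z : ℂ) (t : ℝ), p t • Complex.exp (z * X t) =
      Ψ (Complex.exp (-z * t) • T.op (max t 0) h) := fun z t => by
    rw [map_smul, ← hpΨ, smul_eq_mul, mul_comm, NNReal.smul_def, Complex.real_smul]
    simp [hX, mul_comm]
  have hmgf : ∀ z : ℂ, ω < z.re → Ψ (resolvent T.generator z h) = complexMGF X μ z :=
    fun z hz => by
      obtain ⟨hint, heq⟩ := (hω z hz).2 h
      rw [heq, ← ContinuousLinearMap.integral_comp_comm _ hint, complexMGF, hμ,
        integral_withDensity_eq_integral_smul hpm]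
      exact integral_congr_ae (ae_of_all _ fun t => (hexp z t).symm)
  have hset : Set.Ioi ω ⊆ integrableExpSet X μ := fun x hx => by
    have h1 : Integrable (fun t : ℝ => Ψ (Complex.exp (-(x : ℂ) * t) • T.op (max t 0) h))
        (volume.restrict (Set.Ioi 0)) :=
      Ψ.integrable_comp ((hω x (by simpa using hx)).2 h).1
    have h2 : Integrable (fun t : ℝ => p t • Complex.exp (x * X t)) (volume.restrict (Set.Ioi 0)) :=
      h1.congr (ae_of_all _ fun t => (hexp x t).symm)
    have h3 := ((integrable_withDensity_iff_integrable_smul hpm).2 h2).re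
    refine h3.congr (ae_of_all _ fun t => ?_)
    simp only
    rw [← Complex.ofReal_mul, ← Complex.ofReal_exp]
    exact Complex.ofReal_re _
  set H : ℂ → ℂ := fun z => Ψ (resolvent T.generator z h) with hH
  set Λ : (E →L[ℂ] E) →L[ℂ] ℂ := Ψ.comp (ContinuousLinearMap.apply ℂ E h) with hΛ
  have hHan : ∀ z, z ∈ resolventSet T.generator → AnalyticAt ℂ H z := fun z hz =>
    (Λ.analyticAt _).comp (analyticAt_resolvent hz)
  have hHm : MeromorphicOn H {z : ℂ | a < z.re} := fun z hz => by
    obtain ⟨n, hn⟩ := hmero z hz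
    refine ⟨n, ((Λ.analyticAt _).comp hn).congr (.of_forall fun w => ?_)⟩
    exact map_smul Λ _ _
  have hIoi : Set.Ioi a ⊆ integrableExpSet X μ :=
    Ioi_subset_integrableExpSet hXμ hHm (fun x hx => hHan x (hreal x hx)) hset hmgf
  have hana : ∀ z : ℂ, a < z.re → AnalyticAt ℂ (complexMGF X μ) z := fun z hz =>
    analyticAt_complexMGF (interior_maximal hIoi isOpen_Ioi hz)
  refine ⟨complexMGF X μ, fun z hz => (hana z hz).continuousAt, fun z hz hzρ => ?_, fun z => ?_,
    fun x => ?_⟩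
  · have h1 : H =ᶠ[𝓝[≠] z] complexMGF X μ :=
      MeromorphicOn.eventuallyEq_of_re_gt hHm (fun w hw => (hana w hw).meromorphicAt) hmgf hz
    have h2 : H =ᶠ[𝓝 z] complexMGF X μ :=
      ((hHan z hzρ).frequently_eq_iff_eventually_eq (hana z hz)).1 h1.frequently
    exact h2.eq_of_nhds
  · rw [re_complexMGF_ofReal]
    exact norm_complexMGF_le_mgf
  · rw [complexMGF_ofReal, Complex.ofReal_im]

end C0Semigroup

/-! ### Positive operators and positive functionals -/

namespace Complexification

variable {F : Type*} [NormedAddCommGroup F] [Lattice F] [HasSolidNorm F] [IsOrderedAddMonoid F]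
  [NormedSpace ℝ F] [IsOrderedModule ℝ F] [CompleteSpace F]

omit [HasSolidNorm F] [IsOrderedAddMonoid F] [NormedSpace ℝ F] [IsOrderedModule ℝ F]
  [CompleteSpace F] in
theorem mem_positiveCone {z : Complexification F} :
    z ∈ positiveCone F ↔ 0 ≤ z.re ∧ z.im = 0 := by
  simp [positiveCone]

omit [HasSolidNorm F] [IsOrderedAddMonoid F] [NormedSpace ℝ F] [IsOrderedModule ℝ F]
  [CompleteSpace F] in
theorem mk_zero_mem_positiveCone {x : F} (hx : 0 ≤ x) :
    (⟨x, 0⟩ : Complexification F) ∈ positiveCone F := mem_positiveCone.2 ⟨hx, rfl⟩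

omit [HasSolidNorm F] [IsOrderedModule ℝ F] [CompleteSpace F] in
theorem eq_combination_positive (z : Complexification F) :
    z = (⟨z.re⁺, 0⟩ - ⟨z.re⁻, 0⟩) + Complex.I • (⟨z.im⁺, 0⟩ - ⟨z.im⁻, 0⟩) := by
  ext <;> simp

theorem norm_eq_norm_re {z : Complexification F} (hz : z.im = 0) : ‖z‖ = ‖z.re‖ :=
  le_antisymm (by simpa [hz] using norm_le_add z) (norm_re_le z)

omit [NormedSpace ℝ F] [IsOrderedModule ℝ F] [CompleteSpace F] in
theorem norm_posPart_le (x : F) : ‖x⁺‖ ≤ ‖x‖ :=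
  norm_le_norm_of_abs_le_abs (by
    rw [abs_of_nonneg (posPart_nonneg x)]
    exact sup_le (le_abs_self x) (abs_nonneg x))

omit [NormedSpace ℝ F] [IsOrderedModule ℝ F] [CompleteSpace F] in
theorem norm_negPart_le (x : F) : ‖x⁻‖ ≤ ‖x‖ := by
  have := norm_posPart_le (-x)
  rwa [posPart_neg, norm_neg] at this

/-- A positive operator is bounded on the positive cone. -/
theorem IsPositiveOperator.exists_bound_cone {S : Complexification F →ₗ[ℂ] Complexification F}
    (hS : IsPositiveOperator S) :
    ∃ C, 0 ≤ C ∧ ∀ x : F, 0 ≤ x → ‖S ⟨x, 0⟩‖ ≤ C * ‖x‖ := by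
  by_contra! hcon
  -- The growth `4 ^ n` leaves room for normalization: the `y n` have norm `2 ^ (-n)` and are
  -- summable, yet `S (y n)` exceeds `2 ^ n` in norm although positivity bounds it by the image of
  -- the full sum.
  choose x hx0 hx using fun n : ℕ => hcon (4 ^ n) (by positivity)
  have hxne : ∀ n, x n ≠ 0 := fun n h => by
    have h1 := hx n
    rw [h] at h1
    have h2 : (⟨0, 0⟩ : Complexification F) = 0 := rfl
    simp [h2] at h1
  have hnorm : ∀ n, 0 < ‖x n‖ := fun n => norm_pos_iff.2 (hxne n)
  set c : ℕ → ℝ := fun n => (2 ^ n * ‖x n‖)⁻¹ with hc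
  have hcpos : ∀ n, 0 < c n := fun n => by
    have := hnorm n
    positivity
  set y : ℕ → F := fun n => c n • x n with hy
  have hy0 : ∀ n, 0 ≤ y n := fun n => smul_nonneg (hcpos n).le (hx0 n)
  have hynorm : ∀ n, ‖y n‖ = (1 / 2) ^ n := fun n => by
    have := hnorm n
    rw [hy, norm_smul, Real.norm_of_nonneg (hcpos n).le, hc, one_div, inv_pow]
    field_simp
  have hsum : Summable y := by
    refine Summable.of_norm ?_
    simp_rw [hynorm]
    exact summable_geometric_of_lt_one (by norm_num) (by norm_num)
  have hSy : ∀ n, 2 ^ n < ‖S ⟨y n, 0⟩‖ := fun n => by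
    have h1 : (⟨y n, 0⟩ : Complexification F) = (c n : ℂ) • ⟨x n, 0⟩ := by
      ext <;> simp [hy, -Complex.coe_smul]
    have h2 := hnorm n
    rw [h1, map_smul, norm_smul, Complex.norm_real, Real.norm_of_nonneg (hcpos n).le]
    calc (2 : ℝ) ^ n = c n * (4 ^ n * ‖x n‖) := by
          rw [hc, show (4 : ℝ) = 2 * 2 by norm_num, mul_pow]
          field_simp
      _ < _ := by
          have := hx n
          have := hcpos n
          gcongr
  have hle : ∀ n, ‖S ⟨y n, 0⟩‖ ≤ ‖S ⟨∑' k, y k, 0⟩‖ := fun n => by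
    have h1 := mem_positiveCone.1 (hS _ (mk_zero_mem_positiveCone (hy0 n)))
    have h2 : (⟨∑' k, y k, 0⟩ : Complexification F) = ⟨(∑' k, y k) - y n, 0⟩ + ⟨y n, 0⟩ := by
      ext <;> simp
    have h3 := mem_positiveCone.1 (hS _ (mk_zero_mem_positiveCone
      (sub_nonneg.2 (hsum.le_tsum n fun k _ => hy0 k))))
    rw [norm_eq_norm_re h1.2]
    refine le_trans ?_ (norm_re_le _)
    refine norm_mono h1.1 ?_
    rw [h2, map_add, add_re]
    exact le_add_of_nonneg_left h3.1
  obtain ⟨n, hn⟩ := pow_unbounded_of_one_lt ‖S ⟨∑' k, y k, 0⟩‖ (one_lt_two (α := ℝ))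
  exact absurd (hn.trans (hSy n)) (not_lt.2 (hle n))

/-- Positive operators on Banach lattices are bounded. -/
theorem IsPositiveOperator.exists_clm {S : Complexification F →ₗ[ℂ] Complexification F}
    (hS : IsPositiveOperator S) :
    ∃ S' : Complexification F →L[ℂ] Complexification F, ∀ z, S' z = S z := by
  obtain ⟨C, hC, hb⟩ := hS.exists_bound_cone
  refine ⟨S.mkContinuous (4 * C) fun z => ?_, fun z => rfl⟩
  conv_lhs => rw [eq_combination_positive z]
  rw [map_add, map_smul, map_sub, map_sub]
  have h1 := (hb _ (posPart_nonneg z.re)).trans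
    (mul_le_mul_of_nonneg_left ((norm_posPart_le _).trans (norm_re_le z)) hC)
  have h2 := (hb _ (negPart_nonneg z.re)).trans
    (mul_le_mul_of_nonneg_left ((norm_negPart_le _).trans (norm_re_le z)) hC)
  have h3 := (hb _ (posPart_nonneg z.im)).trans
    (mul_le_mul_of_nonneg_left ((norm_posPart_le _).trans (norm_im_le z)) hC)
  have h4 := (hb _ (negPart_nonneg z.im)).trans
    (mul_le_mul_of_nonneg_left ((norm_negPart_le _).trans (norm_im_le z)) hC)
  refine (norm_add_le _ _).trans ?_
  rw [norm_smul, Complex.norm_I, one_mul]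
  have h5 := norm_sub_le (S ⟨z.re⁺, 0⟩) (S ⟨z.re⁻, 0⟩)
  have h6 := norm_sub_le (S ⟨z.im⁺, 0⟩) (S ⟨z.im⁻, 0⟩)
  linarith

/-- The complex linear extension of a real functional. -/
def extend (φ : F →L[ℝ] ℝ) : Complexification F →L[ℂ] ℂ :=
  LinearMap.mkContinuous
    { toFun := fun z => ⟨φ z.re, φ z.im⟩
      map_add' := fun z w => by apply Complex.ext <;> simp
      map_smul' := fun c z => by apply Complex.ext <;> simp }
    (2 * ‖φ‖) (fun z => by
      have h1 := φ.le_opNorm z.re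
      have h2 := φ.le_opNorm z.im
      have h3 := mul_le_mul_of_nonneg_left (norm_re_le z) (norm_nonneg φ)
      have h4 := mul_le_mul_of_nonneg_left (norm_im_le z) (norm_nonneg φ)
      refine (Complex.norm_le_abs_re_add_abs_im _).trans ?_
      simp only [LinearMap.coe_mk, AddHom.coe_mk]
      rw [← Real.norm_eq_abs, ← Real.norm_eq_abs]
      linarith)

theorem extend_re (φ : F →L[ℝ] ℝ) (z : Complexification F) : (extend φ z).re = φ z.re := rfl

theorem extend_im (φ : F →L[ℝ] ℝ) (z : Complexification F) : (extend φ z).im = φ z.im := rfl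

omit [CompleteSpace F] in
/-- Positive functionals determine the order of a Banach lattice. -/
theorem nonneg_of_forall_functional {x : F}
    (h : ∀ φ : F →L[ℝ] ℝ, (∀ y, 0 ≤ y → 0 ≤ φ y) → 0 ≤ φ x) : 0 ≤ x := by
  by_contra hx
  -- The positive cone is closed and convex, so Hahn–Banach separates it from `x`.
  obtain ⟨φ, hφ, hφx⟩ := (ProperCone.positive ℝ F).hyperplane_separation_point (x₀ := x)
    (by simpa using hx)
  exact absurd (h φ fun y hy => hφ y (by simpa using hy)) (not_le.2 hφx)

omit [CompleteSpace F] in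
theorem eq_zero_of_forall_functional {x : F}
    (h : ∀ φ : F →L[ℝ] ℝ, (∀ y, 0 ≤ y → 0 ≤ φ y) → φ x = 0) : x = 0 := by
  refine le_antisymm ?_ (nonneg_of_forall_functional fun φ hφ => (h φ hφ).ge)
  rw [← neg_nonneg]
  exact nonneg_of_forall_functional fun φ hφ => by rw [map_neg, h φ hφ, neg_zero]

theorem mem_positiveCone_of_forall_functional {z : Complexification F}
    (h : ∀ φ : F →L[ℝ] ℝ, (∀ y, 0 ≤ y → 0 ≤ φ y) → 0 ≤ (extend φ z).re ∧ (extend φ z).im = 0) :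
    z ∈ positiveCone F :=
  mem_positiveCone.2 ⟨nonneg_of_forall_functional fun φ hφ => (h φ hφ).1,
    eq_zero_of_forall_functional fun φ hφ => (h φ hφ).2⟩

theorem eq_zero_of_forall_extend {z : Complexification F}
    (h : ∀ φ : F →L[ℝ] ℝ, (∀ y, 0 ≤ y → 0 ≤ φ y) → extend φ z = 0) : z = 0 := by
  ext
  · exact eq_zero_of_forall_functional fun φ hφ => by rw [← extend_re, h φ hφ, Complex.zero_re]
  · exact eq_zero_of_forall_functional fun φ hφ => by rw [← extend_im, h φ hφ, Complex.zero_im]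

theorem mem_positiveCone_of_tendsto {u : ℕ → Complexification F} {z : Complexification F}
    (hu : Tendsto u atTop (𝓝 z)) (h : ∀ n, u n ∈ positiveCone F) : z ∈ positiveCone F := by
  refine mem_positiveCone_of_forall_functional fun φ hφ => ?_
  have h1 := ((extend φ).continuous.tendsto z).comp hu
  refine ⟨ge_of_tendsto' ((Complex.continuous_re.tendsto _).comp h1) fun n => ?_,
    tendsto_nhds_unique ((Complex.continuous_im.tendsto _).comp h1) ?_⟩
  · exact hφ _ (mem_positiveCone.1 (h n)).1
  · refine tendsto_const_nhds.congr fun n => ?_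
    simp [extend_im, (mem_positiveCone.1 (h n)).2]

theorem clm_eq_zero_of_cone {Q : Complexification F →L[ℂ] Complexification F}
    (h : ∀ f ∈ positiveCone F, Q f = 0) : Q = 0 := by
  ext z : 1
  rw [eq_combination_positive z, map_add, map_smul, map_sub, map_sub,
    h _ (mk_zero_mem_positiveCone (posPart_nonneg _)),
    h _ (mk_zero_mem_positiveCone (negPart_nonneg _)),
    h _ (mk_zero_mem_positiveCone (posPart_nonneg _)),
    h _ (mk_zero_mem_positiveCone (negPart_nonneg _))]
  simp

end Complexification

namespace UnboundedOperator

theorem re_le_spectralBound {E : Type*} [NormedAddCommGroup E]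
    [NormedSpace ℂ E] {A : E →ₗ.[ℂ] E} {l : ℂ} (hl : l ∈ spectrum A) :
    ((l.re : ℝ) : EReal) ≤ spectralBound A :=
  le_iSup₂ (f := fun l (_ : l ∈ spectrum A) => ((l.re : ℝ) : EReal)) l hl

theorem re_le_essentialSpectralBound {E : Type*} [NormedAddCommGroup E]
    [NormedSpace ℂ E] {A : E →ₗ.[ℂ] E} {l : ℂ} (hl : l ∈ essentialSpectrum A) :
    ((l.re : ℝ) : EReal) ≤ essentialSpectralBound A :=
  le_iSup₂ (f := fun l (_ : l ∈ essentialSpectrum A) => ((l.re : ℝ) : EReal)) l hl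

end UnboundedOperator

/-! ### Poles of the resolvent of a locally eventually positive semigroup -/

section LocallyEventuallyPositive

open UnboundedOperator Complexification

variable {F : Type*} [NormedAddCommGroup F] [Lattice F] [HasSolidNorm F]
  [IsOrderedAddMonoid F] [NormedSpace ℝ F] [IsOrderedModule ℝ F] [CompleteSpace F]
  {T : C0Semigroup (Complexification F)}
  {P : ℕ → Complexification F →ₗ[ℂ] Complexification F}

/-- Moving the initial value to `T(τ) f` turns eventual positivity into positivity for all times, as
the Laplace argument requires. For `f = 0` no delay is needed. -/
theorem HasLEP.exists_op_mem_positiveCone (hLEP : HasLEP T P) (n : ℕ) {f : Complexification F}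
    (hf : f ∈ positiveCone F) :
    ∃ τ, 0 ≤ τ ∧ ∀ t, 0 ≤ t → P n (T.op t (T.op τ f)) ∈ positiveCone F := by
  by_cases h0 : f = 0
  · refine ⟨0, le_rfl, fun t _ => ?_⟩
    rw [h0, map_zero, map_zero, map_zero, ← h0]
    exact hf
  · obtain ⟨τ, hτ, h⟩ := hLEP n f hf h0
    refine ⟨τ, hτ.le, fun t ht => ?_⟩
    rw [← T.op_add_apply ht hτ.le]
    exact h _ (by linarith)

/-- Given `n`, `f ≥ 0` and a positive functional `φ`, there are a time shift `h = T(τ) f` and a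
function `Lap` which represents `φ (Pₙ R(z, A) h)` for `Re z > a` and is dominated by its values on
the real axis. -/
theorem HasLEP.exists_laplace (hP : IsPositiveApproximation P) (hLEP : HasLEP T P) {a : ℝ}
    (hmero : ∀ z : ℂ, a < z.re → MeromorphicAt (resolvent T.generator) z)
    (hreal : ∀ x : ℝ, a < x → (x : ℂ) ∈ resolventSet T.generator)
    (n : ℕ) {f : Complexification F} (hf : f ∈ positiveCone F)
    {φ : F →L[ℝ] ℝ} (hφ : ∀ y, 0 ≤ y → 0 ≤ φ y) :
    ∃ (Ψ : Complexification F →L[ℂ] ℂ) (τ : ℝ) (Lap : ℂ → ℂ),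
      (∀ z, Ψ z = extend φ (P n z)) ∧ 0 ≤ τ ∧
      (∀ z : ℂ, a < z.re → ContinuousAt Lap z) ∧
      (∀ z : ℂ, a < z.re → z ∈ resolventSet T.generator →
        Ψ (resolvent T.generator z (T.op τ f)) = Lap z) ∧
      (∀ z : ℂ, ‖Lap z‖ ≤ (Lap (z.re : ℂ)).re) ∧ ∀ x : ℝ, (Lap (x : ℂ)).im = 0 := by
  obtain ⟨P', hP'⟩ := (hP.positive n).exists_clm
  obtain ⟨τ, hτ, hpos⟩ := hLEP.exists_op_mem_positiveCone n hf
  obtain ⟨Lap, h⟩ := T.exists_positive_laplace ((extend φ).comp P') (T.op τ f) (fun t ht => by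
    rw [ContinuousLinearMap.comp_apply, hP', extend_re, extend_im,
      (mem_positiveCone.1 (hpos t ht)).2, map_zero]
    exact ⟨hφ _ (mem_positiveCone.1 (hpos t ht)).1, rfl⟩) hmero hreal
  exact ⟨(extend φ).comp P', τ, Lap, fun z => by rw [ContinuousLinearMap.comp_apply, hP'], hτ, h⟩

variable {l : ℂ} {k : ℕ} {Q : Complexification F →L[ℂ] Complexification F}

/-- `Q` commutes with the semigroup, and its values are eigenvectors of the generator, on which
`T(τ)` acts as the scalar `exp (l τ)`. This is what undoes the time shift. -/
theorem leading_coeff_op (hl : IsResolventPole T.generator l k)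
    (hQ : Tendsto (fun z => (z - l) ^ k • resolvent T.generator z) (𝓝[≠] l) (𝓝 Q))
    {τ : ℝ} (hτ : 0 ≤ τ) (f : Complexification F) :
    Q (T.op τ f) = Complex.exp (l * τ) • Q f := by
  obtain ⟨v, hv, hv'⟩ := hl.exists_eigenvector hQ f
  rw [commute_leading_coeff hl.2.2.1 hQ (fun z hz f => T.resolvent_op_comm hz hτ f), ← hv]
  exact T.op_eigenvector (by rw [hv', hv]) hτ

/-- Positive functionals separate points, `Pₙ` tends strongly to the identity, and the cone spans
the space; the three quantifiers are removed in this order. -/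
theorem leading_coeff_eq_zero (hP : IsPositiveApproximation P)
    (h : ∀ n, ∀ f ∈ positiveCone F, ∀ φ : F →L[ℝ] ℝ, (∀ y, 0 ≤ y → 0 ≤ φ y) →
      extend φ (P n (Q f)) = 0) : Q = 0 := by
  refine clm_eq_zero_of_cone fun f hf => ?_
  refine tendsto_nhds_unique (hP.tendsto_id (Q f)) (tendsto_const_nhds.congr fun n => ?_)
  exact (eq_zero_of_forall_extend fun φ hφ => h n f hf φ hφ).symm

theorem leading_coeff_mem_positiveCone (hP : IsPositiveApproximation P) {f : Complexification F}
    (h : ∀ n, ∀ φ : F →L[ℝ] ℝ, (∀ y, 0 ≤ y → 0 ≤ φ y) →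
      0 ≤ (extend φ (P n (Q f))).re ∧ (extend φ (P n (Q f))).im = 0) :
    Q f ∈ positiveCone F :=
  mem_positiveCone_of_tendsto (hP.tendsto_id (Q f)) fun n =>
    mem_positiveCone_of_forall_functional fun φ hφ => h n φ hφ

theorem tendsto_add_ofReal_nhdsNE (l : ℂ) :
    Tendsto (fun ε : ℝ => l + ε) (𝓝[>] 0) (𝓝[≠] l) := by
  refine tendsto_nhdsWithin_iff.2 ⟨?_, ?_⟩
  · have : Tendsto (fun ε : ℝ => l + ε) (𝓝 0) (𝓝 (l + (0 : ℝ))) :=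
      (continuous_const.add Complex.continuous_ofReal).tendsto 0
    rw [Complex.ofReal_zero, add_zero] at this
    exact this.mono_left nhdsWithin_le_nhds
  · filter_upwards [self_mem_nhdsWithin] with ε hε
    have hε' : ε ≠ 0 := ne_of_gt hε
    simpa using hε'

theorem tendsto_along_real (Ψ : Complexification F →L[ℂ] ℂ)
    (hQ : Tendsto (fun z => (z - l) ^ k • resolvent T.generator z) (𝓝[≠] l) (𝓝 Q))
    (h : Complexification F) :
    Tendsto (fun ε : ℝ => (ε : ℂ) ^ k * Ψ (resolvent T.generator (l + ε) h)) (𝓝[>] 0)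
      (𝓝 (Ψ (Q h))) := by
  have h1 := ((Ψ.continuous.tendsto _).comp (tendsto_smul_resolvent_apply hQ h)).comp
    (tendsto_add_ofReal_nhdsNE l)
  refine h1.congr fun ε => ?_
  simp

/-- There are no poles to the right of a half-line contained in the resolvent set. -/
theorem HasLEP.not_isResolventPole (hP : IsPositiveApproximation P) (hLEP : HasLEP T P) {a : ℝ}
    (hmero : ∀ z : ℂ, a < z.re → MeromorphicAt (resolvent T.generator) z)
    (hreal : ∀ x : ℝ, a < x → (x : ℂ) ∈ resolventSet T.generator) (hl : a < l.re) :
    ¬ IsResolventPole T.generator l k := by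
  intro hpole
  obtain ⟨Q, hQ0, hQ⟩ := hpole.exists_tendsto
  refine hQ0 (leading_coeff_eq_zero hP fun n f hf φ hφ => ?_)
  obtain ⟨Ψ, τ, Lap, hΨ, hτ, hcont, heq, -, -⟩ := hLEP.exists_laplace hP hmero hreal n hf hφ
  have h1 := (Ψ.continuous.tendsto _).comp (tendsto_smul_resolvent_apply hQ (T.op τ f))
  -- Since `Lap` is continuous at `l` and `k ≥ 1`, the factor `(z - l) ^ k` forces the limit to
  -- vanish.
  have h2 : Tendsto (fun z => (z - l) ^ k * Lap z) (𝓝[≠] l) (𝓝 0) := by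
    have h3 : Tendsto (fun z : ℂ => (z - l) ^ k * Lap z) (𝓝 l) (𝓝 ((l - l) ^ k * Lap l)) :=
      (((continuous_id.sub continuous_const).tendsto l).pow k).mul (hcont l hl)
    rw [sub_self, zero_pow (by have := hpole.1; omega), zero_mul] at h3
    exact h3.mono_left nhdsWithin_le_nhds
  have hre : ∀ᶠ z in 𝓝[≠] l, a < z.re :=
    nhdsWithin_le_nhds ((isOpen_lt continuous_const Complex.continuous_re).mem_nhds hl)
  have h4 : Ψ (Q (T.op τ f)) = 0 := by
    refine tendsto_nhds_unique (h1.congr' ?_) h2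
    filter_upwards [hpole.2.2.1, hre] with z hz hza
    rw [Function.comp_apply, map_smul, heq z hza hz, smul_eq_mul]
  rw [leading_coeff_op hpole hQ hτ, map_smul, smul_eq_mul] at h4
  rw [← hΨ]
  exact (mul_eq_zero.1 h4).resolve_left (Complex.exp_ne_zero _)

variable {s : ℝ}

/-- The leading coefficient at a pole which is the rightmost real spectral value is positive. -/
theorem HasLEP.leading_coeff_positive (hP : IsPositiveApproximation P) (hLEP : HasLEP T P)
    (hmero : ∀ z : ℂ, s < z.re → MeromorphicAt (resolvent T.generator) z)
    (hreal : ∀ x : ℝ, s < x → (x : ℂ) ∈ resolventSet T.generator)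
    (hpole : IsResolventPole T.generator (s : ℂ) k)
    (hQ : Tendsto (fun z : ℂ => (z - s) ^ k • resolvent T.generator z) (𝓝[≠] (s : ℂ)) (𝓝 Q))
    {f : Complexification F} (hf : f ∈ positiveCone F) : Q f ∈ positiveCone F := by
  refine leading_coeff_mem_positiveCone hP fun n φ hφ => ?_
  obtain ⟨Ψ, τ, Lap, hΨ, hτ, -, heq, hbd, him⟩ := hLEP.exists_laplace hP hmero hreal n hf hφ
  have h1 := tendsto_along_real Ψ hQ (T.op τ f)
  -- Approaching `s` from the right along the real axis, both `ε ^ k` and the transform are real and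
  -- nonnegative.
  have h2 : ∀ᶠ ε : ℝ in 𝓝[>] 0, ∃ r : ℝ, 0 ≤ r ∧
      (ε : ℂ) ^ k * Ψ (resolvent T.generator (s + ε) (T.op τ f)) = r := by
    filter_upwards [self_mem_nhdsWithin] with ε hε
    have hε0 : (0 : ℝ) < ε := hε
    have h3 := heq ((s + ε : ℝ) : ℂ) (by simpa using hε0) (hreal _ (by linarith))
    have h4 : Lap ((s + ε : ℝ) : ℂ) = ((Lap ((s + ε : ℝ) : ℂ)).re : ℝ) :=
      Complex.ext rfl (him _)
    have h5 : 0 ≤ (Lap ((s + ε : ℝ) : ℂ)).re := (norm_nonneg _).trans (hbd ((s + ε : ℝ) : ℂ))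
    refine ⟨ε ^ k * (Lap ((s + ε : ℝ) : ℂ)).re, by positivity, ?_⟩
    rw [← Complex.ofReal_add, h3, Complex.ofReal_mul, ← h4, Complex.ofReal_pow]
  have h6 : 0 ≤ (Ψ (Q (T.op τ f))).re :=
    ge_of_tendsto ((Complex.continuous_re.tendsto _).comp h1) (h2.mono fun ε ⟨r, hr, hr'⟩ => by
      rw [Function.comp_apply, hr', Complex.ofReal_re]
      exact hr)
  have h7 : (Ψ (Q (T.op τ f))).im = 0 :=
    tendsto_nhds_unique_of_eventuallyEq ((Complex.continuous_im.tendsto _).comp h1)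
      tendsto_const_nhds (h2.mono fun ε ⟨r, _, hr'⟩ => by
        rw [Function.comp_apply, hr', Complex.ofReal_im])
  rw [leading_coeff_op hpole hQ hτ, map_smul, smul_eq_mul, hΨ, ← Complex.ofReal_mul,
    ← Complex.ofReal_exp] at h6 h7
  rw [Complex.re_ofReal_mul] at h6
  rw [Complex.im_ofReal_mul] at h7
  exact ⟨nonneg_of_mul_nonneg_right h6 (Real.exp_pos _),
    (mul_eq_zero.1 h7).resolve_left (Real.exp_pos _).ne'⟩

/-- The order of a pole on the line `Re z = s` is at most the order of the pole `s`. -/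
theorem HasLEP.pole_order_le (hP : IsPositiveApproximation P) (hLEP : HasLEP T P)
    (hmero : ∀ z : ℂ, s < z.re → MeromorphicAt (resolvent T.generator) z)
    (hright : ∀ z : ℂ, s < z.re → z ∈ resolventSet T.generator) {m : ℕ}
    (hs : IsResolventPole T.generator (s : ℂ) m) (hl : l.re = s)
    (hpole : IsResolventPole T.generator l k) : k ≤ m := by
  by_contra! hmk
  obtain ⟨Q, hQ0, hQ⟩ := hpole.exists_tendsto
  obtain ⟨Q', -, hQ'⟩ := hs.exists_tendsto
  refine hQ0 (leading_coeff_eq_zero hP fun n f hf φ hφ => ?_)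
  obtain ⟨Ψ, τ, Lap, hΨ, hτ, -, heq, hbd, -⟩ :=
    hLEP.exists_laplace hP hmero (fun x hx => hright x (by simpa using hx)) n hf hφ
  have h1 := (tendsto_along_real Ψ hQ (T.op τ f)).norm
  have h2 := (tendsto_along_real Ψ hQ' (T.op τ f)).norm
  -- If `k > m`, domination bounds `ε ^ k |Lap (l + ε)|` by `ε ^ (k - m)` times `ε ^ m |Lap (s +
  -- ε)|`, where the second factor converges.
  have hpow : Tendsto (fun ε : ℝ => ε ^ (k - m)) (𝓝[>] 0) (𝓝 0) := by
    have : Tendsto (fun ε : ℝ => ε ^ (k - m)) (𝓝 0) (𝓝 (0 ^ (k - m))) :=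
      (continuous_pow _).tendsto 0
    rw [zero_pow (by omega)] at this
    exact this.mono_left nhdsWithin_le_nhds
  have h3 := hpow.mul h2
  rw [zero_mul] at h3
  have h4 : ‖Ψ (Q (T.op τ f))‖ ≤ 0 := by
    refine le_of_tendsto_of_tendsto h1 h3 ?_
    filter_upwards [self_mem_nhdsWithin] with ε hε
    have hε0 : (0 : ℝ) < ε := hε
    have hre : (l + ε : ℂ).re = s + ε := by simp [hl]
    have hlt : s < (l + ε : ℂ).re := by rw [hre]; linarith
    have hlt' : s < (s + ε : ℂ).re := by simpa using hε0
    rw [heq _ hlt (hright _ hlt), heq _ hlt' (hright _ hlt'), norm_mul, norm_mul, ← mul_assoc,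
      norm_pow, norm_pow, Complex.norm_real, Real.norm_of_nonneg hε0.le, ← pow_add,
      Nat.sub_add_cancel hmk.le]
    gcongr
    refine (hbd _).trans ?_
    rw [hre, Complex.ofReal_add]
    exact Complex.re_le_norm _
  have h5 : Ψ (Q (T.op τ f)) = 0 := norm_le_zero_iff.1 h4
  rw [leading_coeff_op hpole hQ hτ, map_smul, smul_eq_mul] at h5
  rw [← hΨ]
  exact (mul_eq_zero.1 h5).resolve_left (Complex.exp_ne_zero _)

/-- The spectral bound of a locally eventually positive semigroup is a dominant pole of the
resolvent, with a positive eigenvector. -/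
theorem HasLEP.exists_dominant_pole (hP : IsPositiveApproximation P) (hLEP : HasLEP T P)
    (hess : essentialSpectralBound T.generator < spectralBound T.generator) :
    ∃ (s : ℝ) (m : ℕ), spectralBound T.generator = (s : EReal) ∧
      IsResolventPole T.generator (s : ℂ) m ∧
      (∃ v : T.generator.domain, (v : Complexification F) ≠ 0 ∧
        (v : Complexification F) ∈ positiveCone F ∧
        T.generator v = (s : ℂ) • (v : Complexification F)) ∧
      ∀ (l : ℂ) (k : ℕ), l ∈ peripheralSpectrum T.generator →
        IsResolventPole T.generator l k → k ≤ m := by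
  obtain ⟨ω, hω⟩ := T.exists_laplace
  have hle : spectralBound T.generator ≤ (ω : EReal) := by
    refine iSup₂_le fun l hl => ?_
    by_contra hcon
    rw [EReal.coe_le_coe_iff, not_le] at hcon
    exact hl (hω l hcon).1
  -- Exponential growth bounds the spectral bound from above; the strict inequality `hess` excludes
  -- `-∞`.
  obtain ⟨s, hs⟩ : ∃ s : ℝ, spectralBound T.generator = (s : EReal) :=
    ⟨_, (EReal.coe_toReal (hle.trans_lt (EReal.coe_lt_top ω)).ne
      (bot_le.trans_lt hess).ne').symm⟩
  obtain ⟨α, hα₁, hα₂⟩ := EReal.lt_iff_exists_real_btwn.1 hess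
  rw [hs, EReal.coe_lt_coe_iff] at hα₂
  have hfred : ∀ z : ℂ, α < z.re → IsFredholmAt T.generator z := fun z hz => by
    by_contra hcon
    have h1 := (re_le_essentialSpectralBound (A := T.generator) hcon).trans_lt hα₁
    rw [EReal.coe_lt_coe_iff] at h1
    linarith
  have hright : ∀ z : ℂ, s < z.re → z ∈ resolventSet T.generator := fun z hz => by
    by_contra hcon
    have h1 := re_le_spectralBound (A := T.generator) hcon
    rw [hs, EReal.coe_le_coe_iff] at h1
    linarith
  have hmero : ∀ z : ℂ, α < z.re → (∀ᶠ w in 𝓝[≠] z, w ∈ resolventSet T.generator) ∧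
      MeromorphicAt (resolvent T.generator) z := fun z hz =>
    meromorphicAt_resolvent_of_isFredholmAt (U := {z : ℂ | α < z.re})
      (isConnected_re_gt α).isPreconnected hfred
      ⟨((s + 1 : ℝ) : ℂ), by simp; linarith, hright _ (by simp)⟩ hz
  have hpoles : ∀ z : ℂ, α < z.re → z ∈ spectrum T.generator →
      ∃ k, IsResolventPole T.generator z k := fun z hz hzσ =>
    exists_isResolventPole hzσ (hmero z hz).1 (hmero z hz).2
  have hsσ : (s : ℂ) ∈ spectrum T.generator := by
    by_contra hcon
    have hsρ : (s : ℂ) ∈ resolventSet T.generator := not_not.1 hcon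
    obtain ⟨ε, hε, hball⟩ := Metric.isOpen_iff.1 (isOpen_resolventSet T.generator) _ hsρ
    -- If `s` were not spectral, the real half-line of resolvent points would extend left to `a <
    -- s`. By definition of the supremum some spectral value has real part above `a`; it is a pole,
    -- which `HasLEP.not_isResolventPole` forbids.
    set a := max α (s - ε) with ha
    have has : a < s := max_lt hα₂ (by linarith)
    have hreal : ∀ x : ℝ, a < x → (x : ℂ) ∈ resolventSet T.generator := fun x hx => by
      rcases lt_or_ge s x with h | h
      · exact hright x (by simpa using h)
      · refine hball ?_
        rw [Metric.mem_ball, Complex.dist_eq, ← Complex.ofReal_sub, Complex.norm_real,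
          Real.norm_eq_abs, abs_lt]
        have := (le_max_right α (s - ε)).trans_lt hx
        constructor <;> linarith
    have h1 : (a : EReal) < spectralBound T.generator := by
      rw [hs, EReal.coe_lt_coe_iff]
      exact has
    obtain ⟨l, hl⟩ := lt_iSup_iff.1 h1
    obtain ⟨hlσ, hla⟩ := lt_iSup_iff.1 hl
    rw [EReal.coe_lt_coe_iff] at hla
    obtain ⟨k, hk⟩ := hpoles l ((le_max_left _ _).trans_lt hla) hlσ
    exact hLEP.not_isResolventPole hP
      (fun z hz => (hmero z ((le_max_left _ _).trans_lt hz)).2) hreal hla hk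
  obtain ⟨m, hm⟩ := hpoles s (by simpa using hα₂) hsσ
  have hmero' : ∀ z : ℂ, s < z.re → MeromorphicAt (resolvent T.generator) z := fun z hz =>
    (hmero z (hα₂.trans hz)).2
  refine ⟨s, m, hs, hm, ?_, fun l k hl hk => ?_⟩
  · obtain ⟨Q, hQ0, hQ⟩ := hm.exists_tendsto
    obtain ⟨f, hf, hQf⟩ : ∃ f ∈ positiveCone F, Q f ≠ 0 := by
      by_contra! hcon
      exact hQ0 (clm_eq_zero_of_cone hcon)
    obtain ⟨v, hv, hv'⟩ := hm.exists_eigenvector hQ f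
    refine ⟨v, by rwa [hv], ?_, by rw [hv', hv]⟩
    rw [hv]
    exact hLEP.leading_coeff_positive hP hmero' (fun x hx => hright x (by simpa using hx)) hm hQ hf
  · have hlre : l.re = s := by
      have h1 := hl.2
      rw [hs] at h1
      exact_mod_cast h1
    exact hLEP.pole_order_le hP hmero' hright hm hlre hk

end LocallyEventuallyPositive

theorem mainTheorem4 {F : Type*} [NormedAddCommGroup F] [Lattice F] [HasSolidNorm F]
    [IsOrderedAddMonoid F] [NormedSpace ℝ F] [IsOrderedModule ℝ F] [CompleteSpace F]
    (T : C0Semigroup (Complexification F))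
    (P : ℕ → Complexification F →ₗ[ℂ] Complexification F)
    (hP : Complexification.IsPositiveApproximation P)
    (hLEP : HasLEP T P)
    (hess : UnboundedOperator.essentialSpectralBound T.generator
      < UnboundedOperator.spectralBound T.generator) :
    ∃ (s : ℝ) (m : ℕ),
      UnboundedOperator.spectralBound T.generator = (s : EReal) ∧
      UnboundedOperator.IsResolventPole T.generator (s : ℂ) m ∧
      (∃ v : T.generator.domain, (v : Complexification F) ≠ 0 ∧
        (v : Complexification F) ∈ Complexification.positiveCone F ∧
        T.generator v = (s : ℂ) • (v : Complexification F)) ∧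
      ∀ (l : ℂ) (k : ℕ), l ∈ UnboundedOperator.peripheralSpectrum T.generator →
        UnboundedOperator.IsResolventPole T.generator l k → k ≤ m :=
  hLEP.exists_dominant_pole hP hess

end
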